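/- **Theorem (Schur–Sergeev duality).** Let $m,n,d\ge 0$ be integers, let $V=\mathbb C^{m|n}$ be the superspace with standard basis $e_{\bar 1},\dots,e_{\bar m}$ (even), $e_1,\dots,e_n$ (odd), and let $\mathfrak g=\mathfrak{gl}(m|n)$ be the Lie superalgebra of matrices indexed by $I(m|n)=\{\bar 1<\dots<\bar m<1<\dots<n\}$, with $[x,y]=xy-(-1)^{|x||y|}yx$ for homogeneous $x,y$. Let $U(\mathfrak g)$ act on $V^{\otimes d}$ by the algebra homomorphism $\Phi_d$ with $$\Phi_d(g)(v_1\otimes\cdots\otimes v_d)=\sum_{k=1}^d(-1)^{|g|(|v_1|+\cdots+|v_{k-1}|)}\,v_1\otimes\cdots\otimes g v_k\otimes\cdots\otimes v_d$$ for homogeneous $g\in\mathfrak g$, $v_i\in V$, and let $\mathbb C\mathfrak S_d$ act by the algebra homomorphism $\Psi_d$ with $$\Psi_d((i,i+1))(v_1\otimes\cdots\otimes v_d)=(-1)^{|v_i||v_{i+1}|}\,v_1\otimes\cdots\otimes v_{i+1}\otimes v_i\otimes\cdots\otimes v_d .$$ 1. The images of $\Phi_d$ and $\Psi_d$ are each other's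 centralizers in $\operatorname{End}_{\mathbb C}(V^{\otimes d})$: $$\Phi_d(U(\mathfrak g))=\operatorname{End}_{\mathfrak S_d}(V^{\otimes d}),\qquad \operatorname{End}_{U(\mathfrak g)}(V^{\otimes d})=\Psi_d(\mathbb C\mathfrak S_d).$$ 2. Let $\mathcal P(d,m|n)$ be the set of partitions $\lambda$ of $d$ with $\lambda_{m+1}\le n$. As $U(\mathfrak g)\otimes\mathbb C\mathfrak S_d$-modules, $$V^{\otimes d}\;\cong\bigoplus_{\lambda\in\mathcal P(d,m|n)}L(\lambda^\natural)\otimes S^\lambda ,$$ and this decomposition is multiplicity-free: for $\lambda\in\mathcal P(d,m|n)$ the modules $L(\lambda^\natural)$ are simple and pairwise non-isomorphic, and so are the modules $S^\lambda$. Here $S^\lambda$ is the Specht module of $\mathfrak S_d$ (so $S^{(d)}$ is trivial and $S^{(1^d)}$ is the sign module). Let $\delta_1,\dots,\delta_m,\epsilon_1,\dots,\epsilon_n$ be the basis dual to the diagonal matrix units $E_{\bar1\bar1},\dots,E_{\bar m\bar m},E_{11},\dots,E_{nn}$, and let $\nu$ be the transpose of the partition $(\lambda_{m+1},\lambda_{m+2},\dots)$;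 then $\lambda^\natural=\sum_{i=1}^m\lambda_i\delta_i+\sum_{j=1}^n\nu_j\epsilon_j$, and $L(\lambda^\natural)$ is the simple $\mathfrak g$-module of highest weight $\lambda^\natural$ with respect to the Borel subalgebra of upper triangular matrices, i.e. the unique simple quotient of the Verma module of highest weight $\lambda^\natural$. -/

import Mathlib

open scoped TensorProduct DirectSum

noncomputable section

namespace SchurSergeev

/-! ### The superspace `ℂ^{m|n}` and the Lie superalgebra `gl(m|n)` -/

/-- The index set `I(m|n)`: `m` even indices followed by `n` odd ones. Its total order is that of
`Fin m ⊕ₗ Fin n`, i.e. `toLex i < toLex j`. -/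
abbrev Idx (m n : ℕ) : Type := Fin m ⊕ Fin n

/-- The parity of an index, hence of the standard basis vector it labels. -/
def par {m n : ℕ} : Idx m n → ZMod 2
  | .inl _ => 0
  | .inr _ => 1

/-- The Koszul sign `(-1)^{p q}`. -/
def ksign (p q : ZMod 2) : ℂ := (-1) ^ (p.val * q.val)

/-- The natural module `ℂ^{m|n}`. -/
abbrev V (m n : ℕ) : Type := Idx m n → ℂ

/-- The underlying vector space of `gl(m|n)`: matrices indexed by `I(m|n)`. -/
abbrev SuperGL (m n : ℕ) : Type := Matrix (Idx m n) (Idx m n) ℂ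

/-- `x` is homogeneous of parity `p`: its entries `x i j` vanish unless `|i| + |j| = p`. -/
def IsHomog {m n : ℕ} (p : ZMod 2) (x : SuperGL m n) : Prop :=
  ∀ i j, par i + par j ≠ p → x i j = 0

/-- The homogeneous component of parity `p` of a matrix. -/
def homPart {m n : ℕ} (p : ZMod 2) : SuperGL m n →ₗ[ℂ] SuperGL m n where
  toFun x := Matrix.of fun i j => if par i + par j = p then x i j else 0
  map_add' x y := by ext i j; simp only [Matrix.of_apply, Matrix.add_apply]; split_ifs <;> simp
  map_smul' c x := by ext i j; simp

/-- The Lie superbracket `[x, y] = x y - (-1)^{p q} y x` of two homogeneous elements of parities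
`p` and `q`. -/
def superBracket {m n : ℕ} (p q : ZMod 2) (x y : SuperGL m n) : SuperGL m n :=
  x * y - ksign p q • (y * x)

/-! ### The universal enveloping algebra -/

/-- The defining relations `x y = [x, y] + (-1)^{|x||y|} y x` (`x`, `y` homogeneous) of the
enveloping algebra of `gl(m|n)`, on the tensor algebra. -/
inductive UEA.Rel (m n : ℕ) :
    TensorAlgebra ℂ (SuperGL m n) → TensorAlgebra ℂ (SuperGL m n) → Prop
  | bracket (p q : ZMod 2) (x y : SuperGL m n) (hx : IsHomog p x) (hy : IsHomog q y) :
      UEA.Rel m n (TensorAlgebra.ι ℂ x * TensorAlgebra.ι ℂ y)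
        (TensorAlgebra.ι ℂ (superBracket p q x y) +
          ksign p q • (TensorAlgebra.ι ℂ y * TensorAlgebra.ι ℂ x))

/-- The universal enveloping algebra `U(gl(m|n))`. -/
def UEA (m n : ℕ) : Type := RingQuot (UEA.Rel m n)

instance (m n : ℕ) : Ring (UEA m n) := inferInstanceAs (Ring (RingQuot (UEA.Rel m n)))

instance (m n : ℕ) : Algebra ℂ (UEA m n) :=
  inferInstanceAs (Algebra ℂ (RingQuot (UEA.Rel m n)))

/-- The canonical map `gl(m|n) → U(gl(m|n))`. -/
def UEA.ι (m n : ℕ) : SuperGL m n →ₗ[ℂ] UEA m n :=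
  (RingQuot.mkAlgHom ℂ (UEA.Rel m n)).toLinearMap ∘ₗ TensorAlgebra.ι ℂ

/-- The universal property of `U(gl(m|n))`: a linear map into an associative algebra that respects
superbrackets of homogeneous elements extends to an algebra homomorphism. -/
def UEA.lift {m n : ℕ} {A : Type*} [Semiring A] [Algebra ℂ A] (f : SuperGL m n →ₗ[ℂ] A)
    (hf : ∀ (p q : ZMod 2) (x y : SuperGL m n), IsHomog p x → IsHomog q y →
      f x * f y = f (superBracket p q x y) + ksign p q • (f y * f x)) :
    UEA m n →ₐ[ℂ] A :=
  RingQuot.liftAlgHom ℂ ⟨TensorAlgebra.lift ℂ f, by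
    rintro _ _ ⟨p, q, x, y, hx, hy⟩
    simpa using hf p q x y hx hy⟩

theorem UEA.lift_ι {m n : ℕ} {A : Type*} [Semiring A] [Algebra ℂ A] (f : SuperGL m n →ₗ[ℂ] A)
    (hf : ∀ (p q : ZMod 2) (x y : SuperGL m n), IsHomog p x → IsHomog q y →
      f x * f y = f (superBracket p q x y) + ksign p q • (f y * f x)) (x : SuperGL m n) :
    UEA.lift f hf (UEA.ι m n x) = f x := by
  simp only [UEA.lift, UEA.ι]
  erw [RingQuot.liftAlgHom_mkAlgHom_apply]
  simp

/-! ### The two actions on `V^{⊗ d}` -/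

/-- The tensor space `(ℂ^{m|n})^{⊗ d}`. -/
abbrev W (m n d : ℕ) : Type := ⨂[ℂ] _ : Fin d, V m n

/-- The sign operator `v ↦ (-1)^{p |v|} v` on `ℂ^{m|n}`. -/
def signOp (m n : ℕ) (p : ZMod 2) : Module.End ℂ (V m n) :=
  Matrix.toLin' (Matrix.diagonal fun i => ksign p (par i))

/-- `v₁ ⊗ ⋯ ⊗ v_d ↦ (-1)^{p(|v₁| + ⋯ + |v_{k-1}|)} v₁ ⊗ ⋯ ⊗ x v_k ⊗ ⋯ ⊗ v_d`, as a linear function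
of `x`. -/
def slot (m n d : ℕ) (p : ZMod 2) (k : Fin d) : SuperGL m n →ₗ[ℂ] Module.End ℂ (W m n d) :=
  (PiTensorProduct.mapMultilinear ℂ (fun _ : Fin d => V m n) (fun _ : Fin d => V m n)).toLinearMap
    (fun j => if j < k then signOp m n p else LinearMap.id) k ∘ₗ
    (Matrix.toLin' : SuperGL m n ≃ₗ[ℂ] (V m n →ₗ[ℂ] V m n)).toLinearMap

/-- The action of `gl(m|n)` on `V^{⊗ d}`: an element of parity `p` acts by the sum over all tensor
slots `k` of `slot p k`; an arbitrary element acts through its homogeneous components. -/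
def glAct (m n d : ℕ) : SuperGL m n →ₗ[ℂ] Module.End ℂ (W m n d) :=
  ∑ p : ZMod 2, ∑ k : Fin d, slot m n d p k ∘ₗ homPart p

theorem ksign_mul_self (p q : ZMod 2) : ksign p q * ksign p q = 1 := by
  simp [ksign, ← mul_pow]

theorem ksign_comm (p q : ZMod 2) : ksign p q = ksign q p := by
  simp [ksign, mul_comm]

theorem ksign_add_left (p q r : ZMod 2) : ksign (p + q) r = ksign p r * ksign q r := by
  have h : ∀ p q r : ZMod 2, (-1 : ℤ) ^ ((p + q).val * r.val) =
      (-1) ^ (p.val * r.val) * (-1) ^ (q.val * r.val) := by decide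
  have := congrArg (Int.cast : ℤ → ℂ) (h p q r)
  push_cast at this
  exact this

theorem homPart_of_isHomog {m n : ℕ} {p : ZMod 2} {x : SuperGL m n} (hx : IsHomog p x) (q : ZMod 2) :
    homPart q x = if q = p then x else 0 := by
  ext i j
  by_cases h : q = p
  · subst h
    by_cases h' : par i + par j = q
    · simp [homPart, h']
    · simp [homPart, h', hx i j h']
  · by_cases h' : par i + par j = q
    · simp [homPart, h', h, hx i j (h' ▸ h)]
    · simp [homPart, h', h]

theorem glAct_of_isHomog {m n : ℕ} (d : ℕ) {p : ZMod 2} {x : SuperGL m n} (hx : IsHomog p x) :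
    glAct m n d x = ∑ k : Fin d, slot m n d p k x := by
  simp only [glAct, LinearMap.sum_apply, LinearMap.comp_apply, homPart_of_isHomog hx]
  rw [Finset.sum_eq_single p] <;> simp +contextual

theorem IsHomog.mul {m n : ℕ} {p q : ZMod 2} {x y : SuperGL m n} (hx : IsHomog p x)
    (hy : IsHomog q y) : IsHomog (p + q) (x * y) := by
  intro i j hij
  rw [Matrix.mul_apply]
  refine Finset.sum_eq_zero fun k _ => ?_
  by_cases h1 : par i + par k = p
  · by_cases h2 : par k + par j = q
    · exfalso
      apply hij
      have h3 : par k + par k = 0 := CharTwo.add_self_eq_zero _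
      rw [← h1, ← h2]
      linear_combination -h3
    · rw [hy k j h2, mul_zero]
  · rw [hx i k h1, zero_mul]

theorem IsHomog.superBracket {m n : ℕ} {p q : ZMod 2} {x y : SuperGL m n} (hx : IsHomog p x)
    (hy : IsHomog q y) : IsHomog (p + q) (superBracket p q x y) := by
  intro i j hij
  simp [SchurSergeev.superBracket, hx.mul hy i j hij, hy.mul hx i j (by rwa [add_comm q p])]

theorem slot_eq {m n : ℕ} (d : ℕ) (p : ZMod 2) (k : Fin d) (x : SuperGL m n) :
    slot m n d p k x = PiTensorProduct.map (fun j =>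
      if j < k then signOp m n p else if j = k then Matrix.toLin' x else LinearMap.id) := by
  simp only [slot, LinearMap.comp_apply, MultilinearMap.toLinearMap_apply,
    PiTensorProduct.mapMultilinear_apply, LinearEquiv.coe_coe]
  congr 1
  funext j
  by_cases h : j = k
  · subst h; simp
  · simp [h]

theorem signOp_mul (m n : ℕ) (p q : ZMod 2) :
    signOp m n p * signOp m n q = signOp m n (p + q) := by
  rw [signOp, signOp, signOp, Module.End.mul_eq_comp, ← Matrix.toLin'_mul,
    Matrix.diagonal_mul_diagonal]
  simp only [ksign_add_left]

theorem signOp_mul_toLin' {m n : ℕ} {p : ZMod 2} (q : ZMod 2) {x : SuperGL m n} (hx : IsHomog p x) :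
    signOp m n q * Matrix.toLin' x = ksign p q • (Matrix.toLin' x * signOp m n q) := by
  rw [signOp, Module.End.mul_eq_comp, Module.End.mul_eq_comp, ← Matrix.toLin'_mul,
    ← Matrix.toLin'_mul, ← map_smul]
  congr 1
  ext i j
  rw [Matrix.smul_apply, Matrix.diagonal_mul, Matrix.mul_diagonal, smul_eq_mul]
  by_cases h : par i + par j = p
  · have h3 : par j + par j = 0 := CharTwo.add_self_eq_zero _
    have : par i = p + par j := by rw [← h]; linear_combination -h3
    rw [this, ksign_comm q, ksign_add_left, ksign_comm q]
    ring
  · simp [hx i j h]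

theorem slot_mul_self {m n d : ℕ} (p q : ZMod 2) (k : Fin d) (x y : SuperGL m n) :
    slot m n d p k x * slot m n d q k y = slot m n d (p + q) k (x * y) := by
  rw [slot_eq, slot_eq, slot_eq, ← PiTensorProduct.map_mul]
  congr 1
  funext j
  rcases lt_trichotomy j k with h | h | h
  · simp [h, signOp_mul]
  · subst h; simp [Module.End.mul_eq_comp, Matrix.toLin'_mul]
  · simp [h.not_gt, h.ne', Module.End.mul_eq_comp]

theorem slot_comm_of_lt {m n d : ℕ} {p q : ZMod 2} {k l : Fin d} (hkl : k < l) {x y : SuperGL m n}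
    (hx : IsHomog p x) :
    slot m n d q l y * slot m n d p k x = ksign p q • (slot m n d p k x * slot m n d q l y) := by
  rw [slot_eq, slot_eq, ← PiTensorProduct.map_mul, ← PiTensorProduct.map_mul]
  set F : Fin d → Module.End ℂ (V m n) := fun j =>
    (if j < k then signOp m n p else if j = k then Matrix.toLin' x else LinearMap.id) *
    (if j < l then signOp m n q else if j = l then Matrix.toLin' y else LinearMap.id) with hF
  have hupd : (fun j =>
      (if j < l then signOp m n q else if j = l then Matrix.toLin' y else LinearMap.id) *
      (if j < k then signOp m n p else if j = k then Matrix.toLin' x else LinearMap.id)) =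
      Function.update F k (ksign p q • F k) := by
    funext j
    rcases lt_trichotomy j k with h | h | h
    · rw [Function.update_of_ne h.ne]
      simp [hF, h, h.trans hkl, signOp_mul, add_comm]
    · subst h
      simp [hF, hkl, signOp_mul_toLin' q hx]
    · rw [Function.update_of_ne h.ne']
      simp [hF, h.not_gt, h.ne', Module.End.mul_eq_comp]
  rw [hupd, PiTensorProduct.map_update_smul, Function.update_eq_self]

theorem slot_comm_of_ne {m n d : ℕ} {p q : ZMod 2} {k l : Fin d} (hkl : k ≠ l) {x y : SuperGL m n}
    (hx : IsHomog p x) (hy : IsHomog q y) :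
    slot m n d p k x * slot m n d q l y = ksign p q • (slot m n d q l y * slot m n d p k x) := by
  rcases lt_or_gt_of_ne hkl with h | h
  · rw [slot_comm_of_lt h hx, smul_smul, ksign_mul_self, one_smul]
  · rw [slot_comm_of_lt h hy, ksign_comm]

/-- The action of `gl(m|n)` on `V^{⊗ d}` respects superbrackets. -/
theorem glAct_superBracket {m n : ℕ} (d : ℕ) (p q : ZMod 2) (x y : SuperGL m n) (hx : IsHomog p x)
    (hy : IsHomog q y) :
    glAct m n d x * glAct m n d y =
      glAct m n d (superBracket p q x y) + ksign p q • (glAct m n d y * glAct m n d x) := by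
  rw [glAct_of_isHomog d hx, glAct_of_isHomog d hy, glAct_of_isHomog d (hx.superBracket hy),
    Finset.sum_mul_sum, Finset.sum_mul_sum,
    Finset.sum_comm (f := fun i j => slot m n d q i y * slot m n d p j x),
    Finset.smul_sum, ← Finset.sum_add_distrib]
  refine Finset.sum_congr rfl fun k _ => ?_
  rw [← Finset.add_sum_erase _ _ (Finset.mem_univ k),
    ← Finset.add_sum_erase (a := k) (f := fun i => slot m n d q i y * slot m n d p k x) _
      (Finset.mem_univ k), smul_add, ← add_assoc, Finset.smul_sum]
  congr 1
  · rw [slot_mul_self, slot_mul_self, superBracket, map_sub, map_smul, add_comm q p,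
      sub_add_cancel]
  · refine Finset.sum_congr rfl fun l hl => ?_
    exact slot_comm_of_ne (Finset.ne_of_mem_erase hl).symm hx hy

/-- The algebra homomorphism `Φ_d : U(gl(m|n)) → End(V^{⊗ d})`. -/
def Φ (m n d : ℕ) : UEA m n →ₐ[ℂ] Module.End ℂ (W m n d) :=
  UEA.lift (glAct m n d) (glAct_superBracket d)

/-- The basis `e_{f 1} ⊗ ⋯ ⊗ e_{f d}` of `V^{⊗ d}`, where `f : Fin d → I(m|n)`. -/
def tensorBasis (m n d : ℕ) : Module.Basis (Fin d → Idx m n) ℂ (W m n d) :=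
  Basis.piTensorProduct fun _ => Pi.basisFun ℂ (Idx m n)

/-- The sign picked up when `σ` permutes the factors of `e_{f 1} ⊗ ⋯ ⊗ e_{f d}`: the product of
`(-1)^{|e_{f i}| |e_{f j}|}` over all inversions `i < j`, `σ j < σ i`. -/
def permSign {m n d : ℕ} (σ : Equiv.Perm (Fin d)) (f : Fin d → Idx m n) : ℂ :=
  ∏ ij : Fin d × Fin d with ij.1 < ij.2 ∧ σ ij.2 < σ ij.1, ksign (par (f ij.1)) (par (f ij.2))

/-- The operator on `V^{⊗ d}` by which `σ` permutes the tensor factors (the factor in place `i`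
moves to place `σ i`), with the Koszul sign. -/
def permOp (m n : ℕ) {d : ℕ} (σ : Equiv.Perm (Fin d)) : Module.End ℂ (W m n d) :=
  (tensorBasis m n d).constr ℂ fun f => permSign σ f • tensorBasis m n d (f ∘ σ.symm)

theorem permOp_basis {m n d : ℕ} (σ : Equiv.Perm (Fin d)) (f : Fin d → Idx m n) :
    permOp m n σ (tensorBasis m n d f) = permSign σ f • tensorBasis m n d (f ∘ σ.symm) := by
  rw [permOp, Module.Basis.constr_basis]

theorem prod_pairs_perm {d : ℕ} (τ : Equiv.Perm (Fin d)) (G : Fin d → Fin d → ℂ)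
    (hG : ∀ i j, G i j = G j i) :
    ∏ ij : Fin d × Fin d with ij.1 < ij.2, G (τ ij.1) (τ ij.2) =
      ∏ ij : Fin d × Fin d with ij.1 < ij.2, G ij.1 ij.2 := by
  have key : ∀ (ρ : Equiv.Perm (Fin d)) (ij : Fin d × Fin d), ij.1 < ij.2 →
      (if ρ ij.1 < ρ ij.2 then (ρ ij.1, ρ ij.2) else (ρ ij.2, ρ ij.1)).1 <
      (if ρ ij.1 < ρ ij.2 then (ρ ij.1, ρ ij.2) else (ρ ij.2, ρ ij.1)).2 := by
    intro ρ ij h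
    split_ifs with h'
    · exact h'
    · exact lt_of_le_of_ne (not_lt.mp h') fun h'' => h.ne' (ρ.injective h'')
  refine Finset.prod_nbij'
    (fun ij => if τ ij.1 < τ ij.2 then (τ ij.1, τ ij.2) else (τ ij.2, τ ij.1))
    (fun ij => if τ.symm ij.1 < τ.symm ij.2 then (τ.symm ij.1, τ.symm ij.2)
      else (τ.symm ij.2, τ.symm ij.1)) ?_ ?_ ?_ ?_ ?_
  · intro ij h
    simpa using key τ ij (by simpa using h)
  · intro ij h
    simpa using key τ.symm ij (by simpa using h)
  · rintro ⟨i, j⟩ h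
    have h : i < j := by simpa using h
    dsimp only
    split_ifs <;> simp_all [h.not_gt]
  · rintro ⟨i, j⟩ h
    have h : i < j := by simpa using h
    dsimp only
    split_ifs <;> simp_all [h.not_gt]
  · rintro ⟨i, j⟩ _
    dsimp only
    split_ifs
    · rfl
    · exact hG _ _

theorem permSign_eq {m n d : ℕ} (σ : Equiv.Perm (Fin d)) (f : Fin d → Idx m n) :
    permSign σ f = ∏ ij : Fin d × Fin d with ij.1 < ij.2,
      if ij.1 < ij.2 ↔ σ ij.1 < σ ij.2 then 1 else ksign (par (f ij.1)) (par (f ij.2)) := by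
  rw [permSign, ← Finset.filter_filter, Finset.prod_filter]
  refine Finset.prod_congr rfl ?_
  rintro ⟨i, j⟩ h
  have h : i < j := by simpa using h
  have h2 : σ i ≠ σ j := fun h' => h.ne (σ.injective h')
  rcases lt_or_gt_of_ne h2 with h3 | h3
  · simp [h, h3, h3.not_gt]
  · simp [h, h3, h3.not_gt]

theorem permSign_mul {m n d : ℕ} (σ τ : Equiv.Perm (Fin d)) (f : Fin d → Idx m n) :
    permSign (σ * τ) f = permSign σ (f ∘ τ.symm) * permSign τ f := by
  rw [permSign_eq, permSign_eq, permSign_eq,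
    ← prod_pairs_perm τ (fun i j => if i < j ↔ σ i < σ j then 1 else
      ksign (par ((f ∘ τ.symm) i)) (par ((f ∘ τ.symm) j))), ← Finset.prod_mul_distrib]
  · refine Finset.prod_congr rfl ?_
    rintro ⟨i, j⟩ h
    have h : i < j := by simpa using h
    simp only [Equiv.Perm.mul_apply, Function.comp_apply, Equiv.symm_apply_apply]
    have := ksign_mul_self (par (f i)) (par (f j))
    by_cases h1 : τ i < τ j <;> by_cases h2 : σ (τ i) < σ (τ j) <;> simp [h, h1, h2, this]
  · intro i j
    rw [ksign_comm]
    rcases eq_or_ne i j with h | h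
    · subst h; rfl
    · have h' : σ i ≠ σ j := fun h' => h (σ.injective h')
      congr 1
      rw [eq_iff_iff]
      constructor <;> intro hh <;> omega

/-- The representation `Ψ_d` of `𝔖_d` on `V^{⊗ d}`. -/
def permRep (m n d : ℕ) : Representation ℂ (Equiv.Perm (Fin d)) (W m n d) where
  toFun := permOp m n
  map_one' := by
    refine (tensorBasis m n d).ext fun f => ?_
    rw [permOp_basis, permSign, Finset.filter_false_of_mem]
    · rw [Finset.prod_empty, one_smul]
      rfl
    · rintro ⟨i, j⟩ _ ⟨h1, h2⟩
      exact lt_asymm h1 h2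
  map_mul' σ τ := by
    refine (tensorBasis m n d).ext fun f => ?_
    rw [Module.End.mul_apply, permOp_basis, permOp_basis, map_smul, permOp_basis, smul_smul,
      permSign_mul, mul_comm]
    rfl

/-- The group algebra `ℂ𝔖_d`. -/
abbrev GroupAlg (d : ℕ) : Type := MonoidAlgebra ℂ (Equiv.Perm (Fin d))

/-- The algebra homomorphism `Ψ_d : ℂ𝔖_d → End(V^{⊗ d})`. -/
def Ψ (m n d : ℕ) : GroupAlg d →ₐ[ℂ] Module.End ℂ (W m n d) := (permRep m n d).asAlgebraHom

/-! ### Simple highest weight modules of `gl(m|n)` -/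

/-- The left ideal of `U(gl(m|n))` generated by the strictly upper triangular matrix units and by
the elements `E_ii - wt(E_ii)`. Weights are given by their coordinates in the basis of `𝔥*` dual to
the `E_ii`. -/
def vermaIdeal {m n : ℕ} (wt : Idx m n → ℂ) : Submodule (UEA m n) (UEA m n) :=
  Submodule.span (UEA m n)
    ({u | ∃ i j : Idx m n, toLex i < toLex j ∧ u = UEA.ι m n (Matrix.single i j 1)} ∪
     {u | ∃ i : Idx m n, u = UEA.ι m n (Matrix.single i i 1) - algebraMap ℂ (UEA m n) (wt i)})

/-- The Verma module of highest weight `wt` for the standard Borel subalgebra. -/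
abbrev Verma {m n : ℕ} (wt : Idx m n → ℂ) : Type := UEA m n ⧸ vermaIdeal wt

/-- `L(wt)`, the simple module of highest weight `wt`: the quotient of the Verma module by the sum
of all its proper submodules. -/
abbrev L {m n : ℕ} (wt : Idx m n → ℂ) : Type :=
  Verma wt ⧸ sSup {N : Submodule (UEA m n) (Verma wt) | N ≠ ⊤}

/-! ### Hook partitions -/

/-- The set `P(d, m|n)` of partitions `μ` of `d` with `μ_{m+1} ≤ n` (`rowLen` counts rows from
`0`). -/
abbrev HookPartition (d m n : ℕ) : Type :=
  {μ : YoungDiagram // μ.card = d ∧ μ.rowLen m ≤ n}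

/-- The partition `μ⁺ = (μ_{m+1}, μ_{m+2}, …)`. -/
def lowerPart (m : ℕ) (μ : YoungDiagram) : YoungDiagram where
  cells := (μ.cells.filter fun c => m ≤ c.1).image fun c => (c.1 - m, c.2)
  isLowerSet := by
    rintro ⟨i, j⟩ ⟨i', j'⟩ hle hmem
    obtain ⟨hi, hj⟩ := Prod.mk_le_mk.mp hle
    simp only [Finset.coe_image, Finset.coe_filter, Set.mem_image, Set.mem_ofPred_eq,
      Prod.exists, Prod.mk.injEq, YoungDiagram.mem_cells] at hmem ⊢
    obtain ⟨a, b, ⟨hab, hm⟩, rfl, rfl⟩ := hmem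
    exact ⟨m + i', j', ⟨μ.up_left_mem (by omega) hj hab, by omega⟩, by omega, rfl⟩

/-- The weight `μ^♮ = μ_1 δ_1 + ⋯ + μ_m δ_m + ν_1 ε_1 + ⋯ + ν_n ε_n`, where `ν` is the transpose
of `μ⁺`. -/
def natural (m n : ℕ) (μ : YoungDiagram) : Idx m n → ℂ
  | .inl i => (μ.rowLen i : ℂ)
  | .inr j => ((lowerPart m μ).transpose.rowLen j : ℂ)

/-! ### Specht modules -/

/-- A bijective filling of the boxes of a Young diagram with `d` boxes. -/
def tableau {d : ℕ} (μ : YoungDiagram) (hμ : μ.card = d) : Fin d ≃ μ.cells :=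
  (μ.cells.equivFinOfCardEq hμ).symm

/-- The row symmetrizer `∑ σ`, over the permutations `σ` that preserve the rows of the tableau. -/
def rowSymmetrizer {d : ℕ} {μ : YoungDiagram} (T : Fin d ≃ μ.cells) : GroupAlg d :=
  ∑ σ : Equiv.Perm (Fin d) with ∀ a, (T (σ a)).1.1 = (T a).1.1, MonoidAlgebra.of ℂ _ σ

/-- The column antisymmetrizer `∑ sgn(σ) σ`, over the permutations `σ` that preserve the columns of
the tableau. -/
def colAntisymmetrizer {d : ℕ} {μ : YoungDiagram} (T : Fin d ≃ μ.cells) : GroupAlg d :=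
  ∑ σ : Equiv.Perm (Fin d) with ∀ a, (T (σ a)).1.2 = (T a).1.2,
    (Equiv.Perm.sign σ : ℤ) • MonoidAlgebra.of ℂ _ σ

/-- The Specht module `S^μ`: the left ideal of `ℂ𝔖_d` generated by the Young symmetrizer. (The left
ideal generated by the row symmetrizer is the permutation module on tabloids, in which the Young
symmetrizer is the polytabloid of the tableau; so this is the span of all polytabloids.) -/
abbrev Specht {d : ℕ} (μ : YoungDiagram) (hμ : μ.card = d) : Type :=
  Submodule.span (GroupAlg d)
    {colAntisymmetrizer (tableau μ hμ) * rowSymmetrizer (tableau μ hμ)}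

/-! ### The bimodule `⨁ L(λ^♮) ⊗ S^λ` -/

/-- `⨁_{λ ∈ P(d, m|n)} L(λ^♮) ⊗ S^λ`. -/
abbrev Decomp (m n d : ℕ) : Type :=
  ⨁ μ : HookPartition d m n, L (natural m n μ.1) ⊗[ℂ] Specht μ.1 μ.2.1

/-- The action of `u ⊗ s ∈ U(gl(m|n)) ⊗ ℂ𝔖_d` on `⨁ L(λ^♮) ⊗ S^λ`: on each summand
`l ⊗ t ↦ u l ⊗ s t`. -/
def decompAct (m n d : ℕ) (u : UEA m n) (s : GroupAlg d) : Module.End ℂ (Decomp m n d) :=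
  DirectSum.lmap fun μ : HookPartition d m n =>
    TensorProduct.map (Algebra.lsmul ℂ ℂ (L (natural m n μ.1)) u)
      (Algebra.lsmul ℂ ℂ (Specht μ.1 μ.2.1) s)

end SchurSergeev

end

/-!
Averaging over `𝔖_d` shows that an operator commuting with `𝔖_d` is a combination of sums, over all
injective choices of tensor slots, of products of matrices acting in those slots, and by induction
on the number of factors these sums lie in the image of `U(gl(m|n))`. As `ℂ𝔖_d` is semisimple,
Jacobson density gives the other centralizer.

A Young symmetrizer `c` satisfies `c ℂ𝔖_d c ⊆ ℂ c`, so `ℂ𝔖_d c` is simple over `ℂ𝔖_d`, and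
`c V^{⊗d}`, if nonzero, is simple over the commutant, that is, over `U(gl(m|n))`. For `λ` of hook
shape, fill the box `(r, s)` with the even letter `r` if it lies in the first `m` rows and with the
odd letter `s` otherwise. Applying `c_λ` to this word gives a nonzero singular vector of weight
`λ^♮`, so `c_λ V^{⊗d} ≅ L(λ^♮)`; the weights separate the various `λ`.

Conversely every singular vector of tensor space has a weight `λ^♮`. By `sl₂`-theory the even and
the odd parts of its weight are decreasing, and lowering it successively from a given even letter
into the odd letters `1, 2, …` shows that the weight of that even letter is at least the number of
odd letters of nonzero weight. A part of `V^{⊗d}` killed by all the `c_λ` would contain a singular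
vector of some weight `λ^♮`, hence be acted upon like `c_λ V^{⊗d}`; so the `c_λ V^{⊗d}` generate
`V^{⊗d}`.
-/

noncomputable section

namespace SchurSergeev

section TensorBasis

variable {m n d : ℕ}

theorem ksign_ne_zero (p q : ZMod 2) : ksign p q ≠ 0 :=
  left_ne_zero_of_mul (ksign_mul_self p q ▸ one_ne_zero)

theorem ksign_zero_left (q : ZMod 2) : ksign 0 q = 1 := by simp [ksign]

theorem ksign_add_right (p q r : ZMod 2) : ksign p (q + r) = ksign p q * ksign p r := by
  rw [ksign_comm, ksign_add_left, ksign_comm q, ksign_comm r]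

theorem tensorBasis_apply (f : Fin d → Idx m n) :
    tensorBasis m n d f = PiTensorProduct.tprod ℂ fun j => Pi.single (f j) (1 : ℂ) := by
  simp [tensorBasis, Basis.piTensorProduct_apply]

theorem signOp_single (p : ZMod 2) (i : Idx m n) :
    signOp m n p (Pi.single i 1) = ksign p (par i) • Pi.single i (1 : ℂ) := by
  ext j
  rcases eq_or_ne j i with rfl | h
  · simp [signOp, Matrix.mulVec_diagonal]
  · simp [signOp, Matrix.mulVec_diagonal, h]

/-- The sign `(-1)^{p(|f 1| + ⋯ + |f (k-1)|)}` by which `slot m n d p k` acts on the factors to the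
left of the `k`-th one. -/
def slotSign (p : ZMod 2) (k : Fin d) (f : Fin d → Idx m n) : ℂ :=
  ∏ j : Fin d, if j < k then ksign p (par (f j)) else 1

theorem slotSign_ne_zero (p : ZMod 2) (k : Fin d) (f : Fin d → Idx m n) : slotSign p k f ≠ 0 := by
  refine Finset.prod_ne_zero_iff.mpr fun j _ => ?_
  split_ifs
  · exact ksign_ne_zero p _
  · exact one_ne_zero

theorem slot_basis (p : ZMod 2) (k : Fin d) (x : SuperGL m n) (f : Fin d → Idx m n) :
    slot m n d p k x (tensorBasis m n d f) =
      slotSign p k f • ∑ i, x i (f k) • tensorBasis m n d (Function.update f k i) := by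
  have hfactor : ∀ j : Fin d, (if j < k then signOp m n p else if j = k then Matrix.toLin' x
      else LinearMap.id) (Pi.single (f j) (1 : ℂ)) =
      (if j < k then ksign p (par (f j)) else 1) •
        Function.update (fun j => Pi.single (f j) (1 : ℂ)) k
          (∑ i, x i (f k) • Pi.single i (1 : ℂ)) j := by
    intro j
    rcases lt_trichotomy j k with h | h | h
    · simp [h, h.ne, signOp_single]
    · subst h
      ext i
      simp [Finset.sum_apply, Pi.single_apply, -Fintype.sum_sum_type]
    · simp [h.not_gt, h.ne']
  have hupdate (i : Idx m n) : Function.update (fun j => (Pi.single (f j) 1 : V m n)) k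
      (Pi.single i 1) = fun j => Pi.single (Function.update f k i j) 1 := by
    funext j
    rcases eq_or_ne j k with rfl | h <;> simp [*]
  rw [slot_eq, tensorBasis_apply, PiTensorProduct.map_tprod, funext hfactor,
    MultilinearMap.map_smul_univ, MultilinearMap.map_update_sum, slotSign]
  simp only [MultilinearMap.map_update_smul, tensorBasis_apply, hupdate]

theorem slot_single_basis (p : ZMod 2) (k : Fin d) (i j : Idx m n) (f : Fin d → Idx m n) :
    slot m n d p k (Matrix.single i j 1) (tensorBasis m n d f) =
      if f k = j then slotSign p k f • tensorBasis m n d (Function.update f k i) else 0 := by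
  simp only [slot_basis, Matrix.single_apply, ite_smul, one_smul, zero_smul, ite_and,
    Finset.sum_ite_eq, Finset.mem_univ, if_true, eq_comm (a := j), smul_ite, smul_zero]

theorem isHomog_single (i j : Idx m n) (c : ℂ) :
    IsHomog (par i + par j) (Matrix.single i j c) := by
  intro a b h
  rw [Matrix.single_apply, if_neg]
  rintro ⟨rfl, rfl⟩
  exact h rfl

end TensorBasis

/-! ### The actions of `gl(m|n)` and of `𝔖_d` commute -/

section Commute

variable {m n d : ℕ}

theorem permSign_update (σ : Equiv.Perm (Fin d)) (f : Fin d → Idx m n) (k : Fin d)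
    (p : ZMod 2) (i : Idx m n) (hi : par i = p + par (f k)) :
    permSign σ (Function.update f k i) =
      (∏ j, if j < k ∧ σ k < σ j ∨ k < j ∧ σ j < σ k then ksign p (par (f j)) else 1) *
        permSign σ f := by
  have hsplit : ∀ ij : Fin d × Fin d, ij.1 < ij.2 ∧ σ ij.2 < σ ij.1 →
      ksign (par (Function.update f k i ij.1)) (par (Function.update f k i ij.2)) =
      ((if ij.2 = k then ksign p (par (f ij.1)) else 1) *
        (if ij.1 = k then ksign p (par (f ij.2)) else 1)) *
        ksign (par (f ij.1)) (par (f ij.2)) := by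
    rintro ⟨a, b⟩ ⟨hab : a < b, -⟩
    rcases eq_or_ne a k with rfl | ha
    · simp [hab.ne', hi, ksign_add_left]
    · rcases eq_or_ne b k with rfl | hb
      · simp [ha, hi, ksign_add_right, ksign_comm p]
      · simp [ha, hb]
  rw [permSign, permSign, Finset.prod_congr rfl (fun ij h => hsplit ij (by simpa using h)),
    Finset.prod_mul_distrib]
  congr 1
  rw [Finset.prod_mul_distrib, Finset.prod_filter, Finset.prod_filter,
    Fintype.prod_prod_type, Fintype.prod_prod_type_right, ← Finset.prod_mul_distrib]
  refine Finset.prod_congr rfl fun j _ => ?_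
  dsimp only
  rw [Finset.prod_eq_single k, Finset.prod_eq_single k]
  · rcases lt_trichotomy j k with h | h | h
    · simp [h, h.not_gt]
    · simp [h]
    · simp [h, h.not_gt]
  all_goals simp +contextual

theorem permSign_update_mul_slotSign (σ : Equiv.Perm (Fin d)) (f : Fin d → Idx m n) (k : Fin d)
    (p : ZMod 2) (i : Idx m n) (hi : par i = p + par (f k)) :
    permSign σ (Function.update f k i) * slotSign p k f =
      slotSign p (σ k) (f ∘ σ.symm) * permSign σ f := by
  have hcomp : slotSign p (σ k) (f ∘ σ.symm) =
      ∏ j : Fin d, if σ j < σ k then ksign p (par (f j)) else 1 := by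
    rw [slotSign, ← Equiv.prod_comp σ]
    simp
  rw [permSign_update σ f k p i hi, hcomp, mul_right_comm, slotSign, ← Finset.prod_mul_distrib]
  congr 1
  refine Finset.prod_congr rfl fun j _ => ?_
  rcases eq_or_ne j k with rfl | hj
  · simp
  · rcases lt_or_gt_of_ne hj with h | h <;>
      rcases lt_or_gt_of_ne (σ.injective.ne hj) with h' | h' <;>
      simp [h, h', h.not_gt, h'.not_gt, ksign_mul_self]

theorem permOp_mul_slot (σ : Equiv.Perm (Fin d)) {p : ZMod 2} (k : Fin d)
    {x : SuperGL m n} (hx : IsHomog p x) :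
    permOp m n σ * slot m n d p k x = slot m n d p (σ k) x * permOp m n σ := by
  refine (tensorBasis m n d).ext fun f => ?_
  simp only [Module.End.mul_apply, slot_basis, permOp_basis, map_smul, map_sum, smul_smul,
    Finset.smul_sum, Function.comp_apply, Equiv.symm_apply_apply]
  refine Finset.sum_congr rfl fun i _ => ?_
  by_cases h : par i + par (f k) = p
  · have hi : par i = p + par (f k) := by rw [← h, add_assoc, CharTwo.add_self_eq_zero, add_zero]
    have hf : Function.update f k i ∘ σ.symm = Function.update (f ∘ σ.symm) (σ k) i := by
      funext j
      simp [Function.update_apply, Equiv.symm_apply_eq]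
    rw [hf]
    congr 1
    linear_combination (x i (f k)) * permSign_update_mul_slotSign σ f k p i hi
  · simp [hx i (f k) h]

theorem homPart_add (x : SuperGL m n) : homPart 0 x + homPart 1 x = x := by
  ext i j
  have hpar : ∀ a : ZMod 2, a = 0 ∨ a = 1 := by decide
  rcases hpar (par i + par j) with h | h <;> simp [homPart, h]

theorem isHomog_homPart (p : ZMod 2) (x : SuperGL m n) : IsHomog p (homPart p x) := by
  intro i j h
  simp [homPart, h]

theorem permOp_mul_glAct (x : SuperGL m n) (σ : Equiv.Perm (Fin d)) :
    permOp m n σ * glAct m n d x = glAct m n d x * permOp m n σ := by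
  have hhom : ∀ p, permOp m n σ * glAct m n d (homPart p x) =
      glAct m n d (homPart p x) * permOp m n σ := by
    intro p
    rw [glAct_of_isHomog d (isHomog_homPart p x), Finset.mul_sum, Finset.sum_mul,
      ← Equiv.sum_comp σ (fun k => slot m n d p k (homPart p x) * permOp m n σ)]
    exact Finset.sum_congr rfl fun k _ => permOp_mul_slot σ k (isHomog_homPart p x)
  rw [← homPart_add x, map_add, mul_add, add_mul, hhom, hhom]

theorem Φ_ι (x : SuperGL m n) : Φ m n d (UEA.ι m n x) = glAct m n d x :=
  UEA.lift_ι _ _ x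

theorem Ψ_of (σ : Equiv.Perm (Fin d)) : Ψ m n d (MonoidAlgebra.of ℂ _ σ) = permOp m n σ := by
  simp [Ψ, permRep]

theorem UEA.adjoin_range_ι (m n : ℕ) : Algebra.adjoin ℂ (Set.range (UEA.ι m n)) = ⊤ := by
  have h := congrArg (Subalgebra.map (RingQuot.mkAlgHom ℂ (UEA.Rel m n)))
    (TensorAlgebra.adjoin_range_ι (R := ℂ) (M := SuperGL m n))
  rw [AlgHom.map_adjoin, Algebra.map_top,
    (AlgHom.range_eq_top _).mpr (RingQuot.mkAlgHom_surjective ℂ _), ← Set.range_comp] at h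
  exact h

theorem UEA.induction {P : UEA m n → Prop} (hι : ∀ x, P (UEA.ι m n x))
    (halg : ∀ c : ℂ, P (algebraMap ℂ _ c)) (hadd : ∀ u v, P u → P v → P (u + v))
    (hmul : ∀ u v, P u → P v → P (u * v)) (u : UEA m n) : P u := by
  have hu : u ∈ Algebra.adjoin ℂ (Set.range (UEA.ι m n)) := by
    rw [UEA.adjoin_range_ι]; trivial
  induction hu using Algebra.adjoin_induction with
  | mem x hx => obtain ⟨y, rfl⟩ := hx; exact hι y
  | algebraMap r => exact halg r
  | add x y _ _ hx hy => exact hadd x y hx hy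
  | mul x y _ _ hx hy => exact hmul x y hx hy

theorem commute_Ψ_Φ (s : GroupAlg d) (u : UEA m n) : Commute (Ψ m n d s) (Φ m n d u) := by
  induction u using UEA.induction with
  | hι x =>
    induction s using MonoidAlgebra.induction_on with
    | of σ => rw [Ψ_of, Φ_ι]; exact permOp_mul_glAct x σ
    | add a b ha hb => rw [map_add]; exact ha.add_left hb
    | smul r a ha => rw [map_smul]; exact ha.smul_left r
  | halg c => rw [AlgHom.commutes]; exact (Algebra.commutes c _).symm
  | hadd u v hu hv => rw [map_add]; exact hu.add_right hv
  | hmul u v hu hv => rw [map_mul]; exact hu.mul_right hv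

end Commute

/-! ### The image of `Φ_d` is the centralizer of `𝔖_d` -/

theorem sum_sum_embedding {α M : Type*} [Fintype α] [AddCommMonoid M] {r : ℕ}
    (G : α → (Fin r ↪ α) → M) :
    ∑ k, ∑ κ, G k κ =
      ∑ l, ∑ κ, G (κ l) κ + ∑ κ : Fin (r + 1) ↪ α, G (κ 0) (Fin.Embedding.tail κ) := by
  classical
  have hrange (κ : Fin r ↪ α) : ∑ k : {k // k ∈ Set.range κ}, G k κ = ∑ l, G (κ l) κ :=
    ((Equiv.ofInjective κ κ.injective).sum_comp fun k => G k κ).symm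
  have hcompl : ∑ κ : Fin (r + 1) ↪ α, G (κ 0) (Fin.Embedding.tail κ) =
      ∑ κ : Fin r ↪ α, ∑ k : {k // k ∉ Set.range κ}, G k κ :=
    ((Equiv.embeddingFinSucc r α).sum_comp fun s => G s.2 s.1).trans (Fintype.sum_sigma _)
  rw [hcompl, Finset.sum_comm, Finset.sum_comm (s := Finset.univ (α := Fin r)),
    ← Finset.sum_add_distrib]
  refine Finset.sum_congr rfl fun κ _ => ?_
  rw [← hrange]
  convert (Fintype.sum_subtype_add_sum_subtype (· ∈ Set.range κ) fun k => G k κ).symm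

/-- Stated for an `AddCommMonoid` since that of a tensor product does not visibly come from an
`AddCommGroup`. -/
theorem mem_of_add_mem {R M : Type*} [Ring R] [AddCommMonoid M] [Module R M] {N : Submodule R M}
    {x y : M} (hxy : x + y ∈ N) (hx : x ∈ N) : y ∈ N :=
  letI := Module.addCommMonoidToAddCommGroup R (M := M)
  (N.add_mem_iff_right hx).mp hxy

section SlotProd

variable {m n d r : ℕ}

/-- The product over `l` of the matrices `x l` of parities `p l` acting in the tensor slots `κ l`.
-/
def slotProd (p : Fin r → ZMod 2) (x : Fin r → SuperGL m n) (κ : Fin r → Fin d) :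
    Module.End ℂ (W m n d) :=
  (List.ofFn fun l => slot m n d (p l) (κ l) (x l)).prod

theorem slotProd_succ (p : Fin (r + 1) → ZMod 2) (x : Fin (r + 1) → SuperGL m n)
    (κ : Fin (r + 1) → Fin d) :
    slotProd p x κ =
      slot m n d (p 0) (κ 0) (x 0) * slotProd (Fin.tail p) (Fin.tail x) (Fin.tail κ) := by
  simp [slotProd, List.ofFn_succ, Fin.tail]

theorem slot_mul_slotProd {q : ZMod 2} {y : SuperGL m n} (hy : IsHomog q y)
    {p : Fin r → ZMod 2} {x : Fin r → SuperGL m n} (hx : ∀ l, IsHomog (p l) (x l)) (l : Fin r) :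
    ∃ c : ℂ, ∀ κ : Fin r → Fin d, Function.Injective κ →
      slot m n d q (κ l) y * slotProd p x κ =
        c • slotProd (Function.update p l (q + p l)) (Function.update x l (y * x l)) κ := by
  induction r with
  | zero => exact l.elim0
  | succ r ih =>
    induction l using Fin.cases with
    | zero =>
      refine ⟨1, fun κ _ => ?_⟩
      rw [slotProd_succ, slotProd_succ, ← mul_assoc, slot_mul_self]
      simp
    | succ l =>
      obtain ⟨c, hc⟩ := ih (p := Fin.tail p) (x := Fin.tail x) (fun l => hx l.succ) l
      refine ⟨ksign q (p 0) * c, fun κ hκ => ?_⟩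
      have hne : κ l.succ ≠ κ 0 := hκ.ne (Fin.succ_ne_zero l)
      have htail : Function.Injective (Fin.tail κ) := hκ.comp (Fin.succ_injective r)
      rw [slotProd_succ, slotProd_succ, ← mul_assoc, slot_comm_of_ne hne hy (hx 0),
        smul_mul_assoc, mul_assoc, Fin.tail_update_succ, Fin.tail_update_succ,
        Function.update_of_ne (Fin.succ_ne_zero l).symm,
        Function.update_of_ne (Fin.succ_ne_zero l).symm, ← smul_smul]
      exact congrArg (ksign q (p 0) • ·)
        ((congrArg _ (hc _ htail)).trans (mul_smul_comm _ _ _))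

/-- Multiplying the sum for `r` factors by one more element of `gl(m|n)` produces the sum for
`r + 1` factors, plus terms where two factors share a slot and therefore merge into one. -/
theorem sum_slotProd_mem_range {p : Fin r → ZMod 2} {x : Fin r → SuperGL m n}
    (hx : ∀ l, IsHomog (p l) (x l)) :
    ∑ κ : Fin r ↪ Fin d, slotProd p x κ ∈ (Φ m n d).range := by
  induction r with
  | zero => exact Subalgebra.sum_mem _ fun κ _ => by simp [slotProd, one_mem]
  | succ r ih =>
    have htail : ∀ l, IsHomog (Fin.tail p l) (Fin.tail x l) := fun l => hx l.succ
    have hmerged : ∑ l, ∑ κ : Fin r ↪ Fin d,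
        slot m n d (p 0) (κ l) (x 0) * slotProd (Fin.tail p) (Fin.tail x) κ ∈
          (Φ m n d).range := by
      refine Subalgebra.sum_mem _ fun l _ => ?_
      obtain ⟨c, hc⟩ := slot_mul_slotProd (d := d) (hx 0) htail l
      rw [Finset.sum_congr rfl fun (κ : Fin r ↪ Fin d) _ => hc κ κ.injective, ← Finset.smul_sum]
      refine Subalgebra.smul_mem _ (ih fun a => ?_) c
      rcases eq_or_ne a l with rfl | h
      · simpa using (hx 0).mul (htail a)
      · simpa [h] using htail a
    have hprod : glAct m n d (x 0) * ∑ κ : Fin r ↪ Fin d, slotProd (Fin.tail p) (Fin.tail x) κ ∈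
        (Φ m n d).range := Subalgebra.mul_mem _ ⟨_, Φ_ι (x 0)⟩ (ih htail)
    rw [glAct_of_isHomog d (hx 0), Finset.sum_mul_sum, sum_sum_embedding] at hprod
    simp only [slotProd_succ]
    exact mem_of_add_mem (N := Subalgebra.toSubmodule (Φ m n d).range) hprod hmerged

theorem permOp_mul_slotProd (σ : Equiv.Perm (Fin d)) {p : Fin r → ZMod 2}
    {x : Fin r → SuperGL m n} (hx : ∀ l, IsHomog (p l) (x l)) (κ : Fin r → Fin d) :
    permOp m n σ * slotProd p x κ = slotProd p x (σ ∘ κ) * permOp m n σ := by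
  induction r with
  | zero => simp [slotProd]
  | succ r ih =>
    rw [slotProd_succ, slotProd_succ, ← mul_assoc, permOp_mul_slot σ (κ 0) (hx 0), mul_assoc,
      ih (p := Fin.tail p) (x := Fin.tail x) fun l => hx l.succ, ← mul_assoc]
    rfl

theorem prod_slot_single_basis (p : Fin d → ZMod 2) (f g h : Fin d → Idx m n)
    {l : List (Fin d)} (hl : l.Nodup) : ∃ c : ℂ, c ≠ 0 ∧
      (l.map fun k => slot m n d (p k) k (Matrix.single (f k) (g k) 1)).prod
        (tensorBasis m n d h) = if ∀ k ∈ l, h k = g k then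
          c • tensorBasis m n d (fun k => if k ∈ l then f k else h k) else 0 := by
  induction l with
  | nil => exact ⟨1, one_ne_zero, by simp⟩
  | cons a l ih =>
    rw [List.nodup_cons] at hl
    obtain ⟨c, hc, hcl⟩ := ih hl.2
    refine ⟨c * slotSign (p a) a (fun k => if k ∈ l then f k else h k),
      mul_ne_zero hc (slotSign_ne_zero _ _ _), ?_⟩
    rw [List.map_cons, List.prod_cons, Module.End.mul_apply, hcl]
    by_cases htail : ∀ k ∈ l, h k = g k
    · rw [if_pos htail, map_smul, slot_single_basis, if_neg hl.1]
      by_cases ha : h a = g a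
      · rw [if_pos ha, if_pos (by simpa [ha] using htail), smul_smul]
        congr 2
        funext k
        rcases eq_or_ne k a with rfl | hk <;> simp [*]
      · rw [if_neg ha, if_neg (by simp [ha]), smul_zero]
    · rw [if_neg htail, map_zero, if_neg]
      exact fun hcons => htail fun k hk => hcons k (List.mem_cons_of_mem a hk)

theorem exists_linearMap_tensorBasis_eq (f g : Fin d → Idx m n) : ∃ c : ℂ,
    (tensorBasis m n d).linearMap (tensorBasis m n d) (f, g) =
      c • slotProd (fun k => par (f k) + par (g k)) (fun k => Matrix.single (f k) (g k) 1) id := by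
  have hbasis : ∀ h, ∃ c : ℂ, c ≠ 0 ∧ slotProd (fun k => par (f k) + par (g k))
      (fun k => Matrix.single (f k) (g k) 1) id (tensorBasis m n d h) =
        if g = h then c • tensorBasis m n d f else 0 := by
    intro h
    obtain ⟨c, hc, hprod⟩ := prod_slot_single_basis (fun k => par (f k) + par (g k)) f g h
      (List.nodup_finRange d)
    refine ⟨c, hc, ?_⟩
    rw [slotProd, List.ofFn_eq_map]
    simpa [← funext_iff, eq_comm (a := g)] using hprod
  obtain ⟨c, hc, hg⟩ := hbasis g
  refine ⟨c⁻¹, (tensorBasis m n d).ext fun h => ?_⟩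
  rw [Module.Basis.linearMap_apply_apply, LinearMap.smul_apply]
  rcases eq_or_ne g h with rfl | hgh
  · rw [hg, if_pos rfl, if_pos rfl, inv_smul_smul₀ hc]
  · obtain ⟨c', -, hh⟩ := hbasis h
    rw [hh, if_neg hgh, if_neg hgh, smul_zero]

end SlotProd

section Average

variable {m n d : ℕ}

theorem permOp_mul_permOp_inv (σ : Equiv.Perm (Fin d)) : permOp m n σ * permOp m n σ⁻¹ = 1 := by
  rw [← Ψ_of, ← Ψ_of, ← map_mul, ← map_mul, mul_inv_cancel, map_one, map_one]

theorem sum_conj_slotProd_mem_range {p : Fin d → ZMod 2} {x : Fin d → SuperGL m n}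
    (hx : ∀ l, IsHomog (p l) (x l)) :
    ∑ σ : Equiv.Perm (Fin d), permOp m n σ * slotProd p x id * permOp m n σ⁻¹ ∈
      (Φ m n d).range := by
  have hconj (σ : Equiv.Perm (Fin d)) :
      permOp m n σ * slotProd p x id * permOp m n σ⁻¹ = slotProd p x σ := by
    rw [permOp_mul_slotProd σ hx, mul_assoc, permOp_mul_permOp_inv, mul_one, Function.comp_id]
  rw [Finset.sum_congr rfl fun σ _ => hconj σ]
  convert sum_slotProd_mem_range (d := d) hx using 1
  exact ((Equiv.embeddingEquivOfFinite (Fin d)).sum_comp fun σ => slotProd p x σ).symm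

theorem sum_conj_permOp_mem_range (T : Module.End ℂ (W m n d)) :
    ∑ σ : Equiv.Perm (Fin d), permOp m n σ * T * permOp m n σ⁻¹ ∈ (Φ m n d).range := by
  let b := (tensorBasis m n d).linearMap (tensorBasis m n d)
  induction b.mem_span T using Submodule.span_induction with
  | zero => simp
  | add S T _ _ hS hT =>
    simpa only [mul_add, add_mul, Finset.sum_add_distrib] using Subalgebra.add_mem _ hS hT
  | smul a T _ hT =>
    simpa only [mul_smul_comm, smul_mul_assoc, Finset.smul_sum] using Subalgebra.smul_mem _ hT a
  | mem T hT =>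
    obtain ⟨⟨f, g⟩, rfl⟩ := hT
    obtain ⟨c, hc⟩ := exists_linearMap_tensorBasis_eq f g
    simp only [b, hc, mul_smul_comm, smul_mul_assoc, ← Finset.smul_sum]
    exact Subalgebra.smul_mem _ (sum_conj_slotProd_mem_range fun l => isHomog_single _ _ _) _

theorem mem_range_Φ_of_commute {T : Module.End ℂ (W m n d)}
    (hT : ∀ σ : Equiv.Perm (Fin d), permOp m n σ * T = T * permOp m n σ) :
    T ∈ (Φ m n d).range := by
  have hconj (σ : Equiv.Perm (Fin d)) : permOp m n σ * T * permOp m n σ⁻¹ = T := by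
    rw [hT, mul_assoc, permOp_mul_permOp_inv, mul_one]
  have hsum := sum_conj_permOp_mem_range T
  rw [Finset.sum_congr rfl fun σ _ => hconj σ, Finset.sum_const, ← Nat.cast_smul_eq_nsmul ℂ]
    at hsum
  have hcard : ((Finset.univ : Finset (Equiv.Perm (Fin d))).card : ℂ) ≠ 0 := by
    simp [Fintype.card_perm, Nat.factorial_ne_zero]
  exact inv_smul_smul₀ hcard T ▸ Subalgebra.smul_mem _ hsum _

theorem range_Φ_eq_centralizer (m n d : ℕ) : (Φ m n d).range =
    Subalgebra.centralizer ℂ ((Ψ m n d).range : Set (Module.End ℂ (W m n d))) := by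
  refine le_antisymm ?_ fun T hT => mem_range_Φ_of_commute fun σ => ?_
  · rintro _ ⟨u, rfl⟩
    rw [Subalgebra.mem_centralizer_iff]
    rintro _ ⟨s, rfl⟩
    exact commute_Ψ_Φ s u
  · exact Subalgebra.mem_centralizer_iff ℂ |>.mp hT _ ⟨_, Ψ_of σ⟩

end Average

/-! ### Commuting actions of a semisimple algebra and of an algebra mapping onto its commutant -/

theorem exists_mul_mul_self_eq {A : Type*} [Ring A] [IsSemisimpleRing A] (c : A) :
    ∃ x : A, c * x * c = c := by
  obtain ⟨e, he, hspan⟩ := IsSemisimpleRing.ideal_eq_span_idempotent (Ideal.span {c})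
  obtain ⟨x, hx⟩ := Ideal.mem_span_singleton'.mp (hspan ▸ Ideal.mem_span_singleton_self e)
  obtain ⟨y, hy⟩ := Ideal.mem_span_singleton'.mp (hspan ▸ Ideal.mem_span_singleton_self c)
  refine ⟨x, ?_⟩
  rw [mul_assoc, hx, ← hy, mul_assoc, he]

section Annihilated

variable {A W Λ : Type*} [Ring A] [AddCommGroup W] [Module A W]

/-- The largest submodule of `W` on which every `c i` vanishes. -/
def annihilated (W : Type*) [AddCommGroup W] [Module A W] (c : Λ → A) : Submodule A W where
  carrier := {w | ∀ i (a : A), c i • a • w = 0}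
  add_mem' hv hw i a := by rw [smul_add, smul_add, hv, hw, add_zero]
  zero_mem' i a := by rw [smul_zero, smul_zero]
  smul_mem' b w hw i a := by rw [smul_smul a b]; exact hw i (a * b)

theorem isCompl_span_annihilated [IsSemisimpleModule A W] (c : Λ → A) :
    IsCompl (Submodule.span A {v : W | ∃ i w, c i • w = v}) (annihilated W c) := by
  set N := Submodule.span A {v : W | ∃ i w, c i • w = v}
  constructor
  · obtain ⟨q, hq⟩ := exists_isCompl (N ⊓ annihilated W c)
    have hker : N ≤ LinearMap.ker (Submodule.projectionOnto _ q hq) := by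
      refine Submodule.span_le.mpr ?_
      rintro _ ⟨i, w, rfl⟩
      have hw := (Submodule.projectionOnto _ q hq w).2.2 i 1
      rw [one_smul] at hw
      exact LinearMap.mem_ker.mpr ((map_smul _ _ _).trans (Subtype.ext hw))
    rw [disjoint_iff, eq_bot_iff]
    intro w hw
    exact congrArg Subtype.val
      ((Submodule.projectionOnto_apply_left hq ⟨w, hw⟩).symm.trans (hker hw.1))
  · obtain ⟨q, hq⟩ := exists_isCompl N
    refine hq.codisjoint.mono_right fun w hw i a => ?_
    have hmem : c i • a • w ∈ N ⊓ q :=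
      ⟨Submodule.subset_span ⟨i, a • w, rfl⟩, q.smul_mem _ (q.smul_mem _ hw)⟩
    rwa [hq.inf_eq_bot, Submodule.mem_bot] at hmem

theorem exists_smul_eq_projection [IsSemisimpleModule A W] {U : Type*} [SMul U W]
    (hU : ∀ β : Module.End A W, ∃ u : U, ∀ w : W, u • w = β w) (c : Λ → A) :
    ∃ u : U, (∀ w ∈ annihilated W c, u • w = w) ∧ ∀ i (w : W), u • c i • w = 0 := by
  have hcompl := (isCompl_span_annihilated (W := W) c).symm
  obtain ⟨u, hu⟩ := hU ((annihilated W c).subtype ∘ₗ Submodule.projectionOnto _ _ hcompl)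
  refine ⟨u, fun w hw => ?_, fun i w => ?_⟩
  · rw [hu]
    exact congrArg Subtype.val (Submodule.projectionOnto_apply_left hcompl ⟨w, hw⟩)
  · rw [hu, LinearMap.comp_apply, Submodule.projectionOnto_apply_of_mem_right hcompl
      (Submodule.subset_span ⟨i, w, rfl⟩), map_zero]

end Annihilated

section DirectSum

variable {K Λ W : Type*} [Semiring K] [DecidableEq Λ] [AddCommMonoid W] [Module K W]
  {X : Λ → Type*} [∀ i, AddCommMonoid (X i)] [∀ i, Module K (X i)]

theorem toModule_lmap (ev : ∀ i, X i →ₗ[K] W) (S : ∀ i, X i →ₗ[K] X i) (T : Module.End K W)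
    (h : ∀ i x, ev i (S i x) = T (ev i x)) (z : ⨁ i, X i) :
    DirectSum.toModule K Λ W ev (DirectSum.lmap S z) = T (DirectSum.toModule K Λ W ev z) := by
  suffices hcomp : DirectSum.toModule K Λ W ev ∘ₗ DirectSum.lmap S =
      T ∘ₗ DirectSum.toModule K Λ W ev from LinearMap.congr_fun hcomp z
  ext i x
  simp [h]

theorem map_toModule_of_ne (ev : ∀ i, X i →ₗ[K] W) {W' : Type*} [AddCommMonoid W'] [Module K W']
    (T : W →ₗ[K] W') (i : Λ) (h : ∀ j ≠ i, ∀ x, T (ev j x) = 0) (z : ⨁ i, X i) :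
    T (DirectSum.toModule K Λ W ev z) = T (ev i (z i)) := by
  suffices hcomp : T ∘ₗ DirectSum.toModule K Λ W ev =
      T ∘ₗ ev i ∘ₗ DirectSum.component K Λ X i from LinearMap.congr_fun hcomp z
  refine DirectSum.linearMap_ext _ fun j => LinearMap.ext fun x => ?_
  rcases eq_or_ne j i with rfl | hj
  · simp
  · simp [h j hj, DirectSum.component.of, hj]

end DirectSum

section ScalarCorner

variable {K A U W : Type*} [Field K] [Ring A] [Algebra K A]

/-- The corner `c A c` of `c` consists of scalar multiples of `c`. For an idempotent `c` of a
semisimple algebra this says that `c` is primitive with a split simple module `A c`; allowing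
arbitrary `c` avoids normalizing Young symmetrizers. -/
def ScalarCorner (K : Type*) {A : Type*} [Field K] [Ring A] [Algebra K A] (c : A) : Prop :=
  ∀ y : A, ∃ z : K, c * y * c = z • c

variable {c c' : A}

theorem ScalarCorner.exists_mul_eq_smul (h : ScalarCorner K c) (y : A) {s : A}
    (hs : s ∈ Submodule.span A {c}) : ∃ z : K, c * y * s = z • c := by
  obtain ⟨r, rfl⟩ := Submodule.mem_span_singleton.mp hs
  simpa only [smul_eq_mul, mul_assoc] using h (y * r)

variable [IsSemisimpleRing A]

theorem eq_zero_of_mem_span_singleton {s : A} (hs : s ∈ Submodule.span A {c})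
    (h : ∀ y, c * y * s = 0) : s = 0 := by
  obtain ⟨t, ht⟩ := exists_mul_mul_self_eq s
  obtain ⟨r, hr⟩ := Submodule.mem_span_singleton.mp hs
  calc s = r * (c * t * s) := by rw [← mul_assoc, ← mul_assoc, ← smul_eq_mul r c, hr, ht]
    _ = 0 := by rw [h, mul_zero]

theorem isEmpty_span_equiv (h : ∀ y, c * y * c' = 0) (hc : c ≠ 0) :
    IsEmpty (Submodule.span A {c} ≃ₗ[A] Submodule.span A {c'}) := by
  refine ⟨fun e => ?_⟩
  let s : Submodule.span A {c} := ⟨c, Submodule.mem_span_singleton_self c⟩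
  obtain ⟨x, hx⟩ := exists_mul_mul_self_eq c
  have hs : (c * x) • s = s := Subtype.ext hx
  obtain ⟨r, hr⟩ := Submodule.mem_span_singleton.mp (e s).2
  have hes : e s = 0 := by
    rw [← hs, map_smul]
    refine Subtype.ext ?_
    calc c * x * (e s : A) = c * (x * r) * c' := by rw [← hr, smul_eq_mul]; simp only [mul_assoc]
      _ = 0 := h (x * r)
  exact hc (congrArg Subtype.val (e.map_eq_zero_iff.mp hes))

theorem ScalarCorner.exists_mul_eq (h : ScalarCorner K c) {y : A} (hy : y * c ≠ 0) :
    ∃ t : A, c * t * y * c = c := by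
  obtain ⟨t, ht⟩ := exists_mul_mul_self_eq (y * c)
  obtain ⟨z, hz⟩ := h (t * y)
  have hz₀ : z ≠ 0 := by
    rintro rfl
    apply hy
    calc y * c = y * c * t * (y * c) := ht.symm
      _ = y * (c * (t * y) * c) := by simp only [mul_assoc]
      _ = 0 := by rw [hz, zero_smul, mul_zero]
  refine ⟨z⁻¹ • t, ?_⟩
  calc c * (z⁻¹ • t) * y * c = z⁻¹ • (c * (t * y) * c) := by
        simp only [mul_assoc, mul_smul_comm, smul_mul_assoc]
    _ = c := by rw [hz, inv_smul_smul₀ hz₀]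

theorem ScalarCorner.isSimpleModule_span (h : ScalarCorner K c) (hc : c ≠ 0) :
    IsSimpleModule A (Submodule.span A {c}) := by
  rw [isSimpleModule_iff_toSpanSingleton_surjective]
  refine ⟨⟨⟨c, Submodule.mem_span_singleton_self c⟩, 0, fun h0 => hc (congrArg Subtype.val h0)⟩, ?_⟩
  rintro ⟨s, hs⟩ hs₀ ⟨r, hr⟩
  obtain ⟨y, rfl⟩ := Submodule.mem_span_singleton.mp hs
  obtain ⟨r, rfl⟩ := Submodule.mem_span_singleton.mp hr
  obtain ⟨t, ht⟩ := h.exists_mul_eq (y := y) fun h0 => hs₀ (Subtype.ext h0)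
  refine ⟨r * (c * t), Subtype.ext ?_⟩
  change r * (c * t) * (y * c) = r * c
  rw [mul_assoc, ← mul_assoc (c * t), ht]

variable [Ring U] [AddCommGroup W] [Module A W] [Module U W] [SMulCommClass A U W]

/-- The subspace `c W`, as a submodule for an action commuting with that of `c`. -/
def actImage (U W : Type*) {A : Type*} [Ring A] [Ring U] [AddCommGroup W] [Module A W] [Module U W]
    [SMulCommClass A U W] (c : A) : Submodule U W :=
  LinearMap.range (Module.toModuleEnd U W c)

theorem ScalarCorner.exists_end_smul_eq (h : ScalarCorner K c) {w : W} (hw : c • w ≠ 0) (w' : W) :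
    ∃ β : Module.End A W, β (c • w) = c • w' := by
  set f := LinearMap.toSpanSingleton A W (c • w) with hf
  set f' := LinearMap.toSpanSingleton A W (c • w') with hf'
  have hker : LinearMap.ker f ≤ LinearMap.ker f' := by
    intro y hy
    suffices hyc : y * c = 0 by simp [hf', smul_smul, hyc]
    by_contra hyc
    obtain ⟨t, ht⟩ := h.exists_mul_eq hyc
    apply hw
    rw [← ht, mul_smul, mul_smul, show y • c • w = 0 from hy, smul_zero]
  obtain ⟨β, hβ⟩ := IsSemisimpleModule.extension_property ((LinearMap.ker f).liftQ f le_rfl)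
    (LinearMap.ker_eq_bot.mp (Submodule.ker_liftQ_eq_bot' _ _ rfl))
    ((LinearMap.ker f).liftQ f' hker)
  refine ⟨β, ?_⟩
  simpa [hf, hf'] using LinearMap.congr_fun hβ (Submodule.Quotient.mk 1)

theorem ScalarCorner.isSimpleModule_actImage (h : ScalarCorner K c)
    (hU : ∀ β : Module.End A W, ∃ u : U, ∀ w : W, u • w = β w) (hne : ∃ w : W, c • w ≠ 0) :
    IsSimpleModule U (actImage U W c) := by
  rw [isSimpleModule_iff_toSpanSingleton_surjective]
  obtain ⟨w₀, hw₀⟩ := hne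
  refine ⟨⟨⟨c • w₀, w₀, rfl⟩, 0, fun h0 => hw₀ (congrArg Subtype.val h0)⟩, ?_⟩
  rintro ⟨_, w, rfl⟩ hw ⟨_, w', rfl⟩
  obtain ⟨β, hβ⟩ := h.exists_end_smul_eq (fun h0 : c • w = 0 => hw (Subtype.ext h0)) w'
  obtain ⟨u, hu⟩ := hU β
  exact ⟨u, Subtype.ext ((hu _).trans hβ)⟩

theorem ScalarCorner.nonempty_actImage_equiv (h : ScalarCorner K c) (h' : ScalarCorner K c')
    (hU : ∀ β : Module.End A W, ∃ u : U, ∀ w : W, u • w = β w) (hne : ∃ w : W, c • w ≠ 0)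
    (hne' : ∃ w : W, c' • w ≠ 0) {y : A} (hy : c' * y * c ≠ 0) :
    Nonempty (actImage U W c ≃ₗ[U] actImage U W c') := by
  have := h.isSimpleModule_actImage hU hne
  have := h'.isSimpleModule_actImage hU hne'
  let φ : actImage U W c →ₗ[U] actImage U W c' :=
    (Module.toModuleEnd U W (c' * y)).restrict
      fun w _ => ⟨y • w, (mul_smul c' y w).symm⟩
  have hφ : φ ≠ 0 := by
    obtain ⟨w, hw⟩ := hne
    obtain ⟨t, ht⟩ := h.exists_mul_eq hy
    intro h0
    have hzero : (c' * y) • c • w = 0 :=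
      congrArg Subtype.val (LinearMap.congr_fun h0 (⟨c • w, w, rfl⟩ : actImage U W c))
    apply hw
    rw [← ht, mul_smul, mul_smul, hzero, smul_zero]
  exact ⟨LinearEquiv.ofBijective φ (LinearMap.bijective_of_ne_zero hφ)⟩

end ScalarCorner

section Pairing

variable {K A U W : Type*} [Field K] [Ring A] [Algebra K A] [Ring U] [Algebra K U]
  [AddCommGroup W] [Module K W] [Module A W] [Module U W] [SMulCommClass A U W]
  [IsScalarTower K A W] [IsScalarTower K U W]
  {c : A} {L : Type*} [AddCommGroup L] [Module K L] [Module U L] [IsScalarTower K U L]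
  (θ : L ≃ₗ[U] actImage U W c) (x : A)

omit [Algebra K A] [IsScalarTower K A W] in
theorem coe_equiv_smul (z : K) (l : L) : (θ (z • l) : W) = z • (θ l : W) :=
  congrArg Subtype.val ((θ.restrictScalars K).map_smul z l)

/-- The map `l ⊗ s ↦ s x l` from `c W ⊗ A c` to `W`. It is surjective onto `A c W` if
`c x c = c`. -/
def evalPairing : L ⊗[K] Submodule.span A {c} →ₗ[K] W :=
  TensorProduct.lift (LinearMap.mk₂ K
    (fun (l : L) (s : Submodule.span A {c}) => (s : A) • x • (θ l : W))
    (fun l l' s => by simp)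
    (fun z l s => by rw [coe_equiv_smul, smul_comm x z, smul_comm (s : A) z])
    (fun l s s' => by simp [add_smul]) (fun z l s => by simp))

theorem evalPairing_tmul (l : L) (s : Submodule.span A {c}) :
    evalPairing θ x (l ⊗ₜ[K] s) = (s : A) • x • (θ l : W) := by
  simp [evalPairing]

theorem evalPairing_map (u : U) (s : A) (z : L ⊗[K] Submodule.span A {c}) :
    evalPairing θ x (TensorProduct.map (Algebra.lsmul K K L u)
      (Algebra.lsmul K K (Submodule.span A {c}) s) z) = u • s • evalPairing θ x z := by
  induction z using TensorProduct.induction_on with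
  | zero => simp
  | add a b ha hb => rw [map_add, map_add, ha, hb, map_add, smul_add, smul_add]
  | tmul l t =>
    rw [TensorProduct.map_tmul, evalPairing_tmul, evalPairing_tmul]
    simp only [Algebra.lsmul_coe, map_smul, Submodule.coe_smul, smul_eq_mul]
    rw [smul_comm x u, smul_comm _ u, mul_smul]

theorem smul_evalPairing_eq_zero {c' : A} (h : ∀ y, c' * y * c = 0) (y : A)
    (z : L ⊗[K] Submodule.span A {c}) : (c' * y) • evalPairing θ x z = 0 := by
  induction z using TensorProduct.induction_on with
  | zero => simp
  | add a b ha hb => rw [map_add, smul_add, ha, hb, add_zero]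
  | tmul l s =>
    obtain ⟨r, hr⟩ := Submodule.mem_span_singleton.mp s.2
    rw [evalPairing_tmul, smul_smul, ← hr, smul_eq_mul, ← mul_assoc, mul_assoc c', h, zero_smul]

theorem smul_smul_coe_actImage {x : A} (hx : c * x * c = c) (w : actImage U W c) :
    c • x • (w : W) = w := by
  obtain ⟨_, v, rfl⟩ := w
  change c • x • c • v = c • v
  rw [smul_smul, smul_smul, hx]

theorem evalPairing_smul_tmul (hx : c * x * c = c) (w : W) :
    evalPairing θ x (θ.symm ⟨c • w, w, rfl⟩ ⊗ₜ[K] ⟨c, Submodule.mem_span_singleton_self c⟩) =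
      c • w := by
  rw [evalPairing_tmul, LinearEquiv.apply_symm_apply]
  exact smul_smul_coe_actImage (U := U) hx ⟨c • w, w, rfl⟩

theorem eq_zero_of_smul_evalPairing [IsSemisimpleRing A] (hc : ScalarCorner K c)
    (hx : c * x * c = c) (t : L ⊗[K] Submodule.span A {c})
    (ht : ∀ y, (c * y) • evalPairing θ x t = 0) : t = 0 := by
  let b := Module.Basis.ofVectorSpace K L
  obtain ⟨s, rfl⟩ := TensorProduct.eq_repr_basis_left b t
  suffices hs : s = 0 by simp [hs]
  ext j
  refine eq_zero_of_mem_span_singleton (s j).2 fun y => ?_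
  choose ζ hζ using fun k => hc.exists_mul_eq_smul y (s k).2
  have hterm : ∀ k ∈ s.support, (c * y) • evalPairing θ x (b k ⊗ₜ[K] s k) = θ (ζ k • b k) := by
    intro k _
    rw [evalPairing_tmul, smul_smul, hζ, smul_assoc, smul_smul_coe_actImage hx, coe_equiv_smul]
  have hsum : ∑ k ∈ s.support, ζ k • b k = 0 := by
    rw [← LinearEquiv.map_eq_zero_iff θ, ← ZeroMemClass.coe_eq_zero, map_sum, Submodule.coe_sum,
      ← Finset.sum_congr rfl hterm, ← Finset.smul_sum, ← map_sum]
    exact ht y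
  by_cases hj : j ∈ s.support
  · rw [hζ, linearIndependent_iff'.mp b.linearIndependent _ _ hsum j hj, zero_smul]
  · rw [Finsupp.notMem_support_iff.mp hj, ZeroMemClass.coe_zero, mul_zero]

end Pairing

section Bimodule

variable {K A U W : Type*} [Field K] [Ring A] [Algebra K A] [AddCommGroup W] [Module K W]
  [Module A W] [IsScalarTower K A W] [IsSemisimpleRing A]

theorem exists_bimodule_decomposition [Ring U] [Algebra K U] [Module U W] [SMulCommClass A U W]
    [IsScalarTower K U W] {Λ : Type*} (c : Λ → A) (hcorner : ∀ i, ScalarCorner K (c i))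
    (horth : ∀ i j, i ≠ j → ∀ y, c i * y * c j = 0)
    (hspan : Submodule.span A {v : W | ∃ i w, c i • w = v} = ⊤)
    (L : Λ → Type*) [∀ i, AddCommGroup (L i)] [∀ i, Module K (L i)] [∀ i, Module U (L i)]
    [∀ i, IsScalarTower K U (L i)] (θ : ∀ i, L i ≃ₗ[U] actImage U W (c i)) :
    ∃ e : W ≃ₗ[K] ⨁ i, L i ⊗[K] Submodule.span A {c i}, ∀ (u : U) (s : A) (w : W),
      e (u • s • w) = DirectSum.lmap (fun i => TensorProduct.map (Algebra.lsmul K K (L i) u)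
        (Algebra.lsmul K K (Submodule.span A {c i}) s)) (e w) := by
  classical
  choose x hx using fun i => exists_mul_mul_self_eq (c i)
  let E := DirectSum.toModule K Λ W fun i => evalPairing (K := K) (θ i) (x i)
  have hequiv (u : U) (s : A) := toModule_lmap (fun i => evalPairing (K := K) (θ i) (x i)) _
    (Algebra.lsmul K K W u * Algebra.lsmul K K W s)
    fun i z => evalPairing_map (θ i) (x i) u s z
  have hinj : Function.Injective E := by
    rw [injective_iff_map_eq_zero]
    intro z hz
    refine DFinsupp.ext fun i =>
      eq_zero_of_smul_evalPairing (θ i) (x i) (hcorner i) (hx i) _ fun y => ?_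
    have hcomponent := map_toModule_of_ne (fun i => evalPairing (K := K) (θ i) (x i))
      (Algebra.lsmul K K W (c i * y)) i
      (fun j hj => smul_evalPairing_eq_zero (θ j) (x j) (horth i j hj.symm) y) z
    exact hcomponent.symm.trans ((congrArg _ hz).trans (map_zero _))
  have hsurj : Function.Surjective E := by
    refine fun w => Submodule.span_induction (p := fun w _ => w ∈ LinearMap.range E) ?_
      (zero_mem _) (fun _ _ _ _ => add_mem) ?_ (hspan ▸ Submodule.mem_top : w ∈ _)
    · rintro _ ⟨i, w, rfl⟩
      exact ⟨DirectSum.lof K Λ _ i _, (DirectSum.toModule_lof ..).trans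
        (evalPairing_smul_tmul (θ i) (x i) (hx i) w)⟩
    · rintro a _ - ⟨z, rfl⟩
      exact ⟨_, (hequiv 1 a z).trans (one_smul U _)⟩
  let e := LinearEquiv.ofBijective E ⟨hinj, hsurj⟩
  refine ⟨e.symm, fun u s w => e.symm_apply_eq.mpr ?_⟩
  exact (congrArg (fun w => u • s • w) (e.apply_symm_apply w).symm).trans (hequiv u s _).symm

theorem exists_smul_eq_of_commute [Module.Finite K W] {T : Module.End K W}
    (hT : ∀ (β : Module.End A W) (w : W), T (β w) = β (T w)) : ∃ a : A, ∀ w, a • w = T w := by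
  obtain ⟨s, hs⟩ := Module.Finite.fg_top (R := K) (M := W)
  obtain ⟨a, ha⟩ := jacobson_density
    ({ T with map_smul' := hT } : Module.End (Module.End A W) W) s
  exact ⟨a, LinearMap.congr_fun
    (LinearMap.ext_on (f := Algebra.lsmul K K W a) hs fun w hw => (ha w hw).symm)⟩

end Bimodule

/-! ### Highest weight modules -/

theorem UEA.ι_mul_ι {m n : ℕ} {p q : ZMod 2} {x y : SuperGL m n} (hx : IsHomog p x)
    (hy : IsHomog q y) : UEA.ι m n x * UEA.ι m n y =
      UEA.ι m n (superBracket p q x y) + ksign p q • (UEA.ι m n y * UEA.ι m n x) := by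
  have hrel := RingQuot.mkAlgHom_rel ℂ (UEA.Rel.bracket p q x y hx hy)
  rw [map_mul, map_add, map_smul, map_mul] at hrel
  exact hrel

section MatrixUnits

variable {m n : ℕ}

/-- The matrix unit `E_ij` in the enveloping algebra. -/
def unitE (i j : Idx m n) : UEA m n := UEA.ι m n (Matrix.single i j 1)

/-- The position, counted from `0`, of an index in the total order of `I(m|n)`. -/
def pos : Idx m n → ℕ
  | .inl i => i
  | .inr j => m + j

theorem toLex_lt_iff {i j : Idx m n} : toLex i < toLex j ↔ pos i < pos j := by
  rcases i with i | i <;> rcases j with j | j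
  · simp [pos]
  · simp only [Sum.Lex.inl_lt_inr, pos, true_iff]; omega
  · simp only [Sum.Lex.not_inr_lt_inl, pos, false_iff]; omega
  · simp [pos]

theorem pos_injective : Function.Injective (pos : Idx m n → ℕ) := by
  intro i j h
  rcases i with i | i <;> rcases j with j | j <;> simp only [pos] at h
  · exact congrArg _ (Fin.ext h)
  · omega
  · omega
  · exact congrArg _ (Fin.ext (by omega))

theorem unitE_mul_unitE (i j k l : Idx m n) :
    unitE i j * unitE k l = (if j = k then unitE i l else 0) -
      ksign (par i + par j) (par k + par l) • (if l = i then unitE k j else 0) +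
      ksign (par i + par j) (par k + par l) • (unitE k l * unitE i j) := by
  have hsingle (a b c e : Idx m n) : UEA.ι m n (Matrix.single a b 1 * Matrix.single c e 1) =
      if b = c then unitE a e else 0 := by
    split_ifs with h
    · subst h; simp [unitE]
    · simp [h]
  rw [unitE, unitE, UEA.ι_mul_ι (isHomog_single i j 1) (isHomog_single k l 1), superBracket,
    map_sub, map_smul, hsingle, hsingle]

theorem unitE_self_mul_unitE (k i j : Idx m n) :
    unitE k k * unitE i j = unitE i j * unitE k k +
      ((Pi.single i 1 - Pi.single j 1 : Idx m n → ℂ) k) • unitE i j := by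
  rw [unitE_mul_unitE, CharTwo.add_self_eq_zero, ksign_zero_left, one_smul, one_smul, add_comm,
    Pi.sub_apply, sub_smul, Pi.single_apply, Pi.single_apply]
  congr 2
  · split_ifs with h
    · rw [h, one_smul]
    · rw [zero_smul]
  · rcases eq_or_ne k j with rfl | h
    · rw [if_pos rfl, if_pos rfl, one_smul]
    · rw [if_neg h, if_neg h.symm, zero_smul]

theorem UEA.ι_eq_sum (x : SuperGL m n) : UEA.ι m n x = ∑ i, ∑ j, x i j • unitE i j := by
  conv_lhs => rw [Matrix.matrix_eq_sum_single x]
  simp only [map_sum, unitE, ← map_smul, Matrix.smul_single, smul_eq_mul, mul_one]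

/-- The element `∑ pos(i) E_ii`, whose eigenspaces grade the highest weight modules. -/
def gradE (m n : ℕ) : UEA m n := ∑ i, (pos i : ℂ) • unitE i i

theorem gradE_mul_unitE (i j : Idx m n) :
    gradE m n * unitE i j = unitE i j * gradE m n + ((pos i : ℂ) - pos j) • unitE i j := by
  simp only [gradE, Finset.sum_mul, Finset.mul_sum, smul_mul_assoc, unitE_self_mul_unitE, smul_add,
    mul_smul_comm, Finset.sum_add_distrib, smul_smul, ← Finset.sum_smul, Pi.sub_apply, mul_sub,
    Finset.sum_sub_distrib]
  simp [Pi.single_apply, -Fintype.sum_sum_type]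

end MatrixUnits

section Weights

variable {m n : ℕ} (M : Type*) [AddCommGroup M] [Module ℂ M] [Module (UEA m n) M]
  [IsScalarTower ℂ (UEA m n) M]

/-- The vectors of weight `wt`, where weights are given by their values on the `E_ii`. -/
def weightSpace (wt : Idx m n → ℂ) : Submodule ℂ M where
  carrier := {w | ∀ i, unitE i i • w = wt i • w}
  add_mem' hv hw i := by rw [smul_add, smul_add, hv, hw]
  zero_mem' i := by rw [smul_zero, smul_zero]
  smul_mem' z w hw i := by rw [smul_algebra_smul_comm, hw, smul_comm]

/-- The eigenspace of `gradE` for the eigenvalue `z`. -/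
def gradedPiece (m n : ℕ) (M : Type*) [AddCommGroup M] [Module ℂ M] [Module (UEA m n) M]
    [IsScalarTower ℂ (UEA m n) M] (z : ℂ) : Submodule ℂ M :=
  Module.End.eigenspace (Algebra.lsmul ℂ ℂ M (gradE m n)) z

/-- The sum of the eigenspaces of `gradE` for the eigenvalues `z + 1, z + 2, …`: as `gradE` grows
down the order of `I(m|n)`, these lie strictly below the eigenvalue `z`. -/
def lowerSpace (m n : ℕ) (M : Type*) [AddCommGroup M] [Module ℂ M] [Module (UEA m n) M]
    [IsScalarTower ℂ (UEA m n) M] (z : ℂ) : Submodule ℂ M :=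
  ⨆ k : ℕ, gradedPiece m n M (z + (k + 1 : ℕ))

/-- The value of a weight on `gradE`. -/
def gradVal (wt : Idx m n → ℂ) : ℂ := ∑ i, (pos i : ℂ) * wt i

variable {M}

theorem mem_weightSpace {wt : Idx m n → ℂ} {w : M} :
    w ∈ weightSpace M wt ↔ ∀ i, unitE i i • w = wt i • w := Iff.rfl

theorem mem_gradedPiece {z : ℂ} {w : M} : w ∈ gradedPiece m n M z ↔ gradE m n • w = z • w :=
  Module.End.mem_eigenspace_iff

theorem gradVal_add_single_sub_single (wt : Idx m n → ℂ) (i j : Idx m n) :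
    gradVal (wt + Pi.single i 1 - Pi.single j 1) = gradVal wt + (pos i - pos j) := by
  simp only [gradVal, Pi.sub_apply, Pi.add_apply, mul_sub, mul_add, Finset.sum_sub_distrib,
    Finset.sum_add_distrib]
  simp [Pi.single_apply, -Fintype.sum_sum_type, add_sub_assoc]

theorem weightSpace_le_gradedPiece (wt : Idx m n → ℂ) :
    weightSpace M wt ≤ gradedPiece m n M (gradVal wt) := by
  intro w hw
  rw [mem_gradedPiece, gradE, gradVal, Finset.sum_smul, Finset.sum_smul]
  exact Finset.sum_congr rfl fun i _ => by rw [smul_assoc, hw i, smul_smul]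

theorem unitE_smul_mem_weightSpace {wt : Idx m n → ℂ} {w : M} (hw : w ∈ weightSpace M wt)
    (i j : Idx m n) :
    unitE i j • w ∈ weightSpace M (wt + Pi.single i 1 - Pi.single j 1) := by
  intro k
  rw [smul_smul, unitE_self_mul_unitE, add_smul, mul_smul, hw k, smul_algebra_smul_comm,
    smul_assoc, ← add_smul, add_sub_assoc, Pi.add_apply]

theorem unitE_smul_mem_gradedPiece {z : ℂ} {w : M} (hw : w ∈ gradedPiece m n M z)
    (i j : Idx m n) : unitE i j • w ∈ gradedPiece m n M (z + (pos i - pos j)) := by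
  rw [mem_gradedPiece] at hw ⊢
  rw [smul_smul, gradE_mul_unitE, add_smul, mul_smul, hw, smul_algebra_smul_comm, smul_assoc,
    ← add_smul]

theorem eq_of_mem_weightSpace {wt wt' : Idx m n → ℂ} {w : M} (hw : w ∈ weightSpace M wt)
    (hw' : w ∈ weightSpace M wt') (hw₀ : w ≠ 0) : wt = wt' :=
  funext fun i => smul_left_injective ℂ hw₀ ((hw i).symm.trans (hw' i))

theorem disjoint_gradedPiece_lowerSpace {z z₀ : ℂ} (h : ∀ k : ℕ, z ≠ z₀ + (k + 1 : ℕ)) :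
    Disjoint (gradedPiece m n M z) (lowerSpace m n M z₀) :=
  (Module.End.eigenspaces_iSupIndep (Algebra.lsmul ℂ ℂ M (gradE m n)) z).mono_right <|
    iSup_le fun k => le_iSup₂_of_le (z₀ + (k + 1 : ℕ)) (h k).symm le_rfl

theorem disjoint_gradedPiece_self_lowerSpace (z : ℂ) :
    Disjoint (gradedPiece m n M z) (lowerSpace m n M z) :=
  disjoint_gradedPiece_lowerSpace fun k h => Nat.cast_ne_zero.mpr k.succ_ne_zero (left_eq_add.mp h)

section Map

variable {M' : Type*} [AddCommGroup M'] [Module ℂ M'] [Module (UEA m n) M']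
  [IsScalarTower ℂ (UEA m n) M'] (φ : M →ₗ[UEA m n] M')

theorem map_complex_smul (z : ℂ) (w : M) : φ (z • w) = z • φ w := by
  rw [← algebraMap_smul (UEA m n) z w, map_smul, algebraMap_smul]

theorem map_mem_weightSpace {wt : Idx m n → ℂ} {w : M} (hw : w ∈ weightSpace M wt) :
    φ w ∈ weightSpace M' wt := fun i => by rw [← map_smul, hw i, map_complex_smul]

theorem map_mem_gradedPiece {z : ℂ} {w : M} (hw : w ∈ gradedPiece m n M z) :
    φ w ∈ gradedPiece m n M' z := by
  rw [mem_gradedPiece] at hw ⊢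
  rw [← map_smul, hw, map_complex_smul]

theorem map_mem_lowerSpace {z : ℂ} {w : M} (hw : w ∈ lowerSpace m n M z) :
    φ w ∈ lowerSpace m n M' z := by
  induction hw using Submodule.iSup_induction' with
  | mem k w hw => exact Submodule.mem_iSup_of_mem k (map_mem_gradedPiece φ hw)
  | zero => rw [map_zero]; exact zero_mem _
  | add v w _ _ hv hw => rw [map_add]; exact add_mem hv hw

end Map

end Weights

section HighestWeight

variable {m n : ℕ} {M : Type*} [AddCommGroup M] [Module ℂ M] [Module (UEA m n) M]
  [IsScalarTower ℂ (UEA m n) M] {wt : Idx m n → ℂ} {v w : M}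

/-- `v` is a singular vector of weight `wt` for the standard Borel subalgebra. It may be `0`. -/
structure IsSingular (wt : Idx m n → ℂ) (v : M) : Prop where
  upper : ∀ i j : Idx m n, toLex i < toLex j → unitE i j • v = 0
  mem_weightSpace : v ∈ weightSpace M wt

theorem IsSingular.mem_gradedPiece (hv : IsSingular wt v) : v ∈ gradedPiece m n M (gradVal wt) :=
  weightSpace_le_gradedPiece wt hv.mem_weightSpace

theorem IsSingular.map {M' : Type*} [AddCommGroup M'] [Module ℂ M'] [Module (UEA m n) M']
    [IsScalarTower ℂ (UEA m n) M'] (hv : IsSingular wt v) (φ : M →ₗ[UEA m n] M') :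
    IsSingular wt (φ v) where
  upper i j h := by rw [← map_smul, hv.upper i j h, map_zero]
  mem_weightSpace := map_mem_weightSpace φ hv.mem_weightSpace

/-- The vectors obtained from `v` by applying strictly lower triangular matrix units. -/
inductive IsLowerMonomial (m n : ℕ) {M : Type*} [AddCommGroup M] [Module (UEA m n) M] (v : M) :
    M → Prop
  | base : IsLowerMonomial m n v v
  | step (w : M) (i j : Idx m n) (hw : IsLowerMonomial m n v w) (h : pos j < pos i) :
      IsLowerMonomial m n v (unitE i j • w)

/-- The span of the vectors obtained from `v` by applying strictly lower triangular matrix units;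
for singular `v` it is the submodule generated by `v`. -/
def lowerSpan (m n : ℕ) {M : Type*} [AddCommGroup M] [Module ℂ M] [Module (UEA m n) M] (v : M) :
    Submodule ℂ M :=
  Submodule.span ℂ {w | IsLowerMonomial m n v w}

theorem unitE_smul_mem_lowerSpan {i j : Idx m n} (hij : pos j < pos i) (hw : w ∈ lowerSpan m n v) :
    unitE i j • w ∈ lowerSpan m n v := by
  induction hw using Submodule.span_induction with
  | mem w hw => exact Submodule.subset_span (IsLowerMonomial.step w i j hw hij)
  | zero => rw [smul_zero]; exact zero_mem _
  | add a b _ _ ha hb => rw [smul_add]; exact add_mem ha hb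
  | smul c a _ ha => rw [smul_algebra_smul_comm]; exact Submodule.smul_mem _ c ha

theorem IsSingular.unitE_smul_mem_lowerSpan (hv : IsSingular wt v) (hw : IsLowerMonomial m n v w)
    (i j : Idx m n) : unitE i j • w ∈ lowerSpan m n v := by
  induction hw generalizing i j with
  | base =>
    have hvv : v ∈ lowerSpan m n v := Submodule.subset_span .base
    rcases lt_trichotomy (pos i) (pos j) with h | h | h
    · rw [hv.upper i j (toLex_lt_iff.mpr h)]; exact zero_mem _
    · rw [pos_injective h, hv.mem_weightSpace]; exact Submodule.smul_mem _ _ hvv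
    · exact SchurSergeev.unitE_smul_mem_lowerSpan h hvv
  | step w a b _ hab ih =>
    have hite (P : Prop) [Decidable P] (k l : Idx m n) :
        (if P then unitE k l else 0) • w ∈ lowerSpan m n v := by
      split_ifs
      · exact ih k l
      · rw [zero_smul]; exact zero_mem _
    rw [smul_smul, unitE_mul_unitE, add_smul, sub_smul, smul_assoc, smul_assoc, mul_smul]
    exact add_mem (sub_mem (hite _ _ _) (Submodule.smul_mem _ _ (hite _ _ _)))
      (Submodule.smul_mem _ _ (SchurSergeev.unitE_smul_mem_lowerSpan hab (ih i j)))

theorem IsSingular.smul_mem_lowerSpan (hv : IsSingular wt v) (u : UEA m n)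
    (hw : w ∈ lowerSpan m n v) : u • w ∈ lowerSpan m n v := by
  induction u using UEA.induction generalizing w with
  | hι x =>
    induction hw using Submodule.span_induction with
    | mem w hw =>
      simp only [UEA.ι_eq_sum, Finset.sum_smul, smul_assoc]
      exact sum_mem fun i _ => sum_mem fun j _ =>
        Submodule.smul_mem _ _ (hv.unitE_smul_mem_lowerSpan hw i j)
    | zero => rw [smul_zero]; exact zero_mem _
    | add a b _ _ ha hb => rw [smul_add]; exact add_mem ha hb
    | smul c a _ ha => rw [smul_algebra_smul_comm]; exact Submodule.smul_mem _ c ha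
  | halg c => rw [algebraMap_smul]; exact Submodule.smul_mem _ c hw
  | hadd a b ha hb => rw [add_smul]; exact add_mem (ha hw) (hb hw)
  | hmul a b ha hb => rw [mul_smul]; exact ha (hb hw)

theorem IsLowerMonomial.eq_or_mem_gradedPiece (hw : IsLowerMonomial m n v w) {z : ℂ}
    (hv : v ∈ gradedPiece m n M z) :
    w = v ∨ ∃ k : ℕ, w ∈ gradedPiece m n M (z + (k + 1 : ℕ)) := by
  induction hw with
  | base => exact Or.inl rfl
  | step w i j _ hij ih =>
    have hshift (l : ℕ) :
        z + l + ((pos i : ℂ) - pos j) = z + (l + (pos i - pos j - 1) + 1 : ℕ) := by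
      rw [show l + (pos i - pos j - 1) + 1 = l + (pos i - pos j) by omega, Nat.cast_add,
        Nat.cast_sub hij.le, add_assoc]
    right
    rcases ih with rfl | ⟨k, hk⟩
    · exact ⟨_, hshift 0 ▸ unitE_smul_mem_gradedPiece (by simpa using hv) i j⟩
    · exact ⟨_, hshift (k + 1) ▸ unitE_smul_mem_gradedPiece hk i j⟩

theorem IsSingular.exists_sub_smul_mem_lowerSpace (hv : IsSingular wt v)
    (hgen : Submodule.span (UEA m n) {v} = ⊤) (w : M) :
    ∃ a : ℂ, w - a • v ∈ lowerSpace m n M (gradVal wt) := by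
  have hw : w ∈ lowerSpan m n v := by
    obtain ⟨u, rfl⟩ := Submodule.mem_span_singleton.mp (hgen ▸ Submodule.mem_top : w ∈ _)
    exact hv.smul_mem_lowerSpan u (Submodule.subset_span .base)
  induction hw using Submodule.span_induction with
  | mem w hw =>
    rcases hw.eq_or_mem_gradedPiece hv.mem_gradedPiece with rfl | ⟨k, hk⟩
    · exact ⟨1, by rw [one_smul, sub_self]; exact zero_mem _⟩
    · exact ⟨0, by rw [zero_smul, sub_zero]; exact Submodule.mem_iSup_of_mem k hk⟩
  | zero => exact ⟨0, by rw [zero_smul, sub_zero]; exact zero_mem _⟩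
  | add x y _ _ hx hy =>
    obtain ⟨a, ha⟩ := hx
    obtain ⟨b, hb⟩ := hy
    exact ⟨a + b, by rw [add_smul, add_sub_add_comm]; exact add_mem ha hb⟩
  | smul c x _ hx =>
    obtain ⟨a, ha⟩ := hx
    exact ⟨c * a, by rw [mul_smul, ← smul_sub]; exact Submodule.smul_mem _ c ha⟩

theorem IsSingular.mem_lowerSpace_of_mem (hv : IsSingular wt v)
    (hgen : Submodule.span (UEA m n) {v} = ⊤) {N : Submodule (UEA m n) M} (hN : N ≠ ⊤)
    (hw : w ∈ N) : w ∈ lowerSpace m n M (gradVal wt) := by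
  obtain ⟨a, ha⟩ := hv.exists_sub_smul_mem_lowerSpace hgen w
  have hquot : a • N.mkQ v = 0 := by
    refine Submodule.disjoint_def.mp (disjoint_gradedPiece_self_lowerSpace (gradVal wt)) _
      (Submodule.smul_mem _ a (hv.map N.mkQ).mem_gradedPiece) ?_
    have hlower := map_mem_lowerSpace N.mkQ ha
    rw [map_sub, map_complex_smul, Submodule.mkQ_apply, (Submodule.Quotient.mk_eq_zero N).mpr hw,
      zero_sub, neg_mem_iff] at hlower
    exact hlower
  rcases smul_eq_zero.mp hquot with rfl | h
  · rwa [zero_smul, sub_zero] at ha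
  · refine absurd (eq_top_iff.mpr ?_) hN
    rw [← hgen, Submodule.span_singleton_le_iff_mem]
    exact (Submodule.Quotient.mk_eq_zero N).mp h

theorem IsSingular.isCoatom_sSup (hv : IsSingular wt v)
    (hgen : Submodule.span (UEA m n) {v} = ⊤) (hv₀ : v ≠ 0) :
    IsCoatom (sSup {N : Submodule (UEA m n) M | N ≠ ⊤}) := by
  refine ⟨fun htop => hv₀ ?_, fun N hN => by_contra fun hne => hN.not_ge (le_sSup hne)⟩
  have hmem : v ∈ sSup {N : Submodule (UEA m n) M | N ≠ ⊤} := by rw [htop]; trivial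
  refine Submodule.disjoint_def.mp (disjoint_gradedPiece_self_lowerSpace (gradVal wt)) v
    hv.mem_gradedPiece ?_
  rw [sSup_eq_iSup'] at hmem
  exact Submodule.iSup_induction _ (motive := (· ∈ lowerSpace m n M (gradVal wt))) hmem
    (fun N w hw => hv.mem_lowerSpace_of_mem hgen N.2 hw) (zero_mem _) fun _ _ => add_mem

theorem IsSingular.mem_gradedPiece_cases (hv : IsSingular wt v)
    (hgen : Submodule.span (UEA m n) {v} = ⊤) {z : ℂ} (hw : w ∈ gradedPiece m n M z)
    (hw₀ : w ≠ 0) :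
    (z = gradVal wt ∧ ∃ a : ℂ, w = a • v) ∨ ∃ k : ℕ, z = gradVal wt + (k + 1 : ℕ) := by
  by_contra! h
  obtain ⟨a, ha⟩ := hv.exists_sub_smul_mem_lowerSpace hgen w
  have hdisj := disjoint_gradedPiece_lowerSpace (m := m) (n := n) (M := M) h.2
  rcases eq_or_ne z (gradVal wt) with rfl | hz
  · refine h.1 rfl a (sub_eq_zero.mp (Submodule.disjoint_def.mp hdisj _ ?_ ha))
    exact sub_mem hw (Submodule.smul_mem _ a hv.mem_gradedPiece)
  · refine hw₀ (Submodule.disjoint_def.mp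
      (Module.End.eigenspaces_iSupIndep (Algebra.lsmul ℂ ℂ M (gradE m n)) z) w hw ?_)
    have hle : lowerSpace m n M (gradVal wt) ≤
        ⨆ y ≠ z, Module.End.eigenspace (Algebra.lsmul ℂ ℂ M (gradE m n)) y :=
      iSup_le fun k => le_iSup₂_of_le _ (h.2 k).symm le_rfl
    rw [← sub_add_cancel w (a • v)]
    exact add_mem (hle ha) (Submodule.smul_mem _ a
      (Submodule.mem_iSup_of_mem _ (Submodule.mem_iSup_of_mem hz.symm hv.mem_gradedPiece)))

end HighestWeight

section Simple

variable {m n : ℕ} {M M' : Type*} [AddCommGroup M] [Module ℂ M] [Module (UEA m n) M]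
  [IsScalarTower ℂ (UEA m n) M] [AddCommGroup M'] [Module ℂ M'] [Module (UEA m n) M']
  [IsScalarTower ℂ (UEA m n) M'] {wt wt' : Idx m n → ℂ} {v : M} {v' : M'}

theorem isSingular_mk_one (wt : Idx m n → ℂ) :
    IsSingular wt (Submodule.Quotient.mk 1 : Verma wt) where
  upper i j h := by
    rw [← Submodule.Quotient.mk_smul, smul_eq_mul, mul_one, Submodule.Quotient.mk_eq_zero]
    exact Submodule.subset_span (Or.inl ⟨i, j, h, rfl⟩)
  mem_weightSpace i := by
    rw [← algebraMap_smul (UEA m n) (wt i), ← Submodule.Quotient.mk_smul,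
      ← Submodule.Quotient.mk_smul, smul_eq_mul, mul_one, smul_eq_mul, mul_one,
      Submodule.Quotient.eq]
    exact Submodule.subset_span (Or.inr ⟨i, rfl⟩)

theorem span_mk_one {R : Type*} [Ring R] (I : Submodule R R) :
    Submodule.span R {(Submodule.Quotient.mk 1 : R ⧸ I)} = ⊤ := by
  rw [eq_top_iff]
  rintro ⟨u⟩ _
  exact Submodule.mem_span_singleton.mpr
    ⟨u, by rw [← Submodule.Quotient.mk_smul, smul_eq_mul, mul_one]; rfl⟩

theorem IsSingular.exists_vermaHom (hv : IsSingular wt v) :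
    ∃ φ : Verma wt →ₗ[UEA m n] M, φ (Submodule.Quotient.mk 1) = v := by
  have hker : vermaIdeal wt ≤ LinearMap.ker (LinearMap.toSpanSingleton (UEA m n) M v) := by
    rw [vermaIdeal, Submodule.span_le]
    rintro _ (⟨i, j, h, rfl⟩ | ⟨i, rfl⟩)
    · exact hv.upper i j h
    · exact (sub_smul _ _ v).trans (by
        rw [algebraMap_smul, sub_eq_zero]; exact hv.mem_weightSpace i)
  exact ⟨(vermaIdeal wt).liftQ _ hker, by
    rw [Submodule.liftQ_apply, LinearMap.toSpanSingleton_apply, one_smul]⟩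

theorem IsSingular.isCoatom_sSup_verma (hv : IsSingular wt v) (hv₀ : v ≠ 0) :
    IsCoatom (sSup {N : Submodule (UEA m n) (Verma wt) | N ≠ ⊤}) := by
  obtain ⟨φ, rfl⟩ := hv.exists_vermaHom
  exact (isSingular_mk_one wt).isCoatom_sSup (span_mk_one _) fun h => hv₀ (by rw [h, map_zero])

theorem ker_eq_sSup_of_isSimpleModule [IsSimpleModule (UEA m n) M] {φ : Verma wt →ₗ[UEA m n] M}
    (hφ : φ (Submodule.Quotient.mk 1) ≠ 0) :
    LinearMap.ker φ = sSup {N : Submodule (UEA m n) (Verma wt) | N ≠ ⊤} := by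
  have hφ₀ : φ ≠ 0 := fun h => hφ (by rw [h, LinearMap.zero_apply])
  have hcoatom := LinearMap.isCoatom_ker_of_surjective (LinearMap.surjective_of_ne_zero hφ₀)
  have hsup := ((isSingular_mk_one wt).map φ).isCoatom_sSup_verma hφ
  exact ((hcoatom.le_iff.mp (le_sSup hcoatom.1)).resolve_left hsup.1).symm

theorem IsSingular.nonempty_L_equiv [IsSimpleModule (UEA m n) M] (hv : IsSingular wt v)
    (hv₀ : v ≠ 0) : Nonempty (L wt ≃ₗ[UEA m n] M) := by
  obtain ⟨φ, rfl⟩ := hv.exists_vermaHom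
  have hφ₀ : φ ≠ 0 := fun h => hv₀ (by rw [h, LinearMap.zero_apply])
  exact ⟨(Submodule.quotEquivOfEq _ _ (ker_eq_sSup_of_isSimpleModule hv₀).symm).trans
    (φ.quotKerEquivOfSurjective (LinearMap.surjective_of_ne_zero hφ₀))⟩

theorem IsSingular.smul_eq_zero_of_smul_eq_zero [IsSimpleModule (UEA m n) M']
    (hv : IsSingular wt v) (hv₀ : v ≠ 0) (hv' : IsSingular wt v') {u : UEA m n}
    (hu : u • v = 0) : u • v' = 0 := by
  obtain ⟨φ, rfl⟩ := hv.exists_vermaHom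
  obtain ⟨φ', rfl⟩ := hv'.exists_vermaHom
  by_cases hv₀' : φ' (Submodule.Quotient.mk 1) = 0
  · rw [hv₀', smul_zero]
  have hker : LinearMap.ker φ ≤ LinearMap.ker φ' := by
    rw [ker_eq_sSup_of_isSimpleModule hv₀']
    exact le_sSup fun h => hv₀ (LinearMap.mem_ker.mp (h ▸ Submodule.mem_top))
  rw [← map_smul] at hu ⊢
  exact hker hu

theorem IsSingular.weight_eq_of_equiv [IsSimpleModule (UEA m n) M] [IsSimpleModule (UEA m n) M']
    (hv : IsSingular wt v) (hv₀ : v ≠ 0) (hv' : IsSingular wt' v') (hv₀' : v' ≠ 0)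
    (e : M ≃ₗ[UEA m n] M') : wt = wt' := by
  have hev : e v ≠ 0 := e.map_ne_zero_iff.mpr hv₀
  have hev' : e.symm v' ≠ 0 := e.symm.map_ne_zero_iff.mpr hv₀'
  have hsing : IsSingular wt (e v) := hv.map e.toLinearMap
  rcases hv'.mem_gradedPiece_cases (IsSimpleModule.span_singleton_eq_top _ hv₀')
    hsing.mem_gradedPiece hev with ⟨-, a, ha⟩ | ⟨k, hk⟩
  · exact eq_of_mem_weightSpace hsing.mem_weightSpace
      (ha ▸ Submodule.smul_mem _ a hv'.mem_weightSpace) hev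
  · exfalso
    rcases hv.mem_gradedPiece_cases (IsSimpleModule.span_singleton_eq_top _ hv₀)
      (hv'.map e.symm.toLinearMap).mem_gradedPiece hev' with ⟨h, -⟩ | ⟨l, hl⟩
    · rw [h, left_eq_add, Nat.cast_eq_zero] at hk
      exact k.succ_ne_zero hk
    · rw [hl, add_assoc, left_eq_add, ← Nat.cast_add, Nat.cast_eq_zero] at hk
      omega

end Simple

/-! ### Weights of tensor space -/

section TensorSpace

variable {m n d : ℕ}

instance : Module (UEA m n) (W m n d) := Module.compHom (W m n d) (Φ m n d).toRingHom

instance : Module (GroupAlg d) (W m n d) := Module.compHom (W m n d) (Ψ m n d).toRingHom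

theorem UEA_smul_def (u : UEA m n) (w : W m n d) : u • w = Φ m n d u w := rfl

theorem groupAlg_smul_def (s : GroupAlg d) (w : W m n d) : s • w = Ψ m n d s w := rfl

instance : IsScalarTower ℂ (UEA m n) (W m n d) where
  smul_assoc z u w := by rw [UEA_smul_def, map_smul]; rfl

instance : IsScalarTower ℂ (GroupAlg d) (W m n d) where
  smul_assoc z u w := by rw [groupAlg_smul_def, map_smul]; rfl

instance : SMulCommClass (GroupAlg d) (UEA m n) (W m n d) where
  smul_comm s u w := LinearMap.congr_fun (commute_Ψ_Φ s u) w

instance : Module.Finite ℂ (W m n d) := Module.Finite.of_basis (tensorBasis m n d)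

theorem exists_UEA_smul_eq (β : Module.End (GroupAlg d) (W m n d)) :
    ∃ u : UEA m n, ∀ w : W m n d, u • w = β w := by
  obtain ⟨u, hu⟩ := mem_range_Φ_of_commute (T := β.restrictScalars ℂ) fun σ =>
    LinearMap.ext fun w => by
      rw [← Ψ_of]
      exact (β.map_smul (MonoidAlgebra.of ℂ _ σ) w).symm
  exact ⟨u, fun w => LinearMap.congr_fun hu w⟩

/-- The number of occurrences of the letter `i` in the word `f`; the `content f i` are the
coordinates of the weight of `e_f`. -/
def content (f : Fin d → Idx m n) (i : Idx m n) : ℕ := (Finset.univ.filter fun k => f k = i).card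

theorem sum_content (f : Fin d → Idx m n) : ∑ i, content f i = d := by
  simpa only [content, Finset.card_univ, Fintype.card_fin] using
    (Finset.card_eq_sum_card_fiberwise (f := f) (s := Finset.univ) (t := Finset.univ)
      fun _ _ => Finset.mem_coe.mpr (Finset.mem_univ _)).symm

theorem content_comp_perm (f : Fin d → Idx m n) (σ : Equiv.Perm (Fin d)) :
    content (f ∘ σ) = content f :=
  funext fun _ => Finset.card_equiv σ fun _ => by
    simp only [Function.comp_apply, Finset.mem_filter_univ]

theorem unitE_smul_basis (i j : Idx m n) (f : Fin d → Idx m n) :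
    unitE i j • tensorBasis m n d f = ∑ k : Fin d, if f k = j then
      slotSign (par i + par j) k f • tensorBasis m n d (Function.update f k i) else 0 := by
  rw [UEA_smul_def, unitE, Φ_ι, glAct_of_isHomog d (isHomog_single i j 1), LinearMap.sum_apply]
  exact Finset.sum_congr rfl fun k _ => slot_single_basis _ k i j f

theorem tensorBasis_mem_weightSpace (f : Fin d → Idx m n) :
    tensorBasis m n d f ∈ weightSpace (W m n d) fun i => (content f i : ℂ) := by
  intro i
  rw [unitE_smul_basis]
  dsimp only [content]
  rw [Finset.cast_card, Finset.sum_smul, Finset.sum_filter]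
  refine Finset.sum_congr rfl fun k _ => ?_
  split_ifs with h
  · rw [← h, Function.update_eq_self, CharTwo.add_self_eq_zero, slotSign]
    simp only [ksign_zero_left, ite_self, Finset.prod_const_one]
  · rfl

theorem coord_unitE_self_smul (i : Idx m n) (w : W m n d) (f : Fin d → Idx m n) :
    (tensorBasis m n d).coord f (unitE i i • w) =
      content f i * (tensorBasis m n d).coord f w := by
  refine LinearMap.congr_fun (f := (tensorBasis m n d).coord f ∘ₗ Φ m n d (unitE i i))
    (g := (content f i : ℂ) • (tensorBasis m n d).coord f) ((tensorBasis m n d).ext fun g => ?_) w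
  rw [LinearMap.comp_apply, ← UEA_smul_def, tensorBasis_mem_weightSpace g i, map_smul,
    LinearMap.smul_apply, Module.Basis.coord_apply, Module.Basis.repr_self]
  rcases eq_or_ne g f with rfl | h
  · rfl
  · rw [Finsupp.single_eq_of_ne' h, smul_zero, smul_zero]

theorem eq_content_of_coord_ne_zero {i : Idx m n} {z : ℂ} {w : W m n d} {f : Fin d → Idx m n}
    (hw : unitE i i • w = z • w) (hf : (tensorBasis m n d).coord f w ≠ 0) : z = content f i := by
  refine mul_right_cancel₀ hf ?_
  rw [← coord_unitE_self_smul, hw, map_smul, smul_eq_mul]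

theorem exists_coord_ne_zero {w : W m n d} (hw₀ : w ≠ 0) :
    ∃ f, (tensorBasis m n d).coord f w ≠ 0 := by
  contrapose! hw₀
  exact (tensorBasis m n d).forall_coord_eq_zero_iff.mp hw₀

theorem exists_eq_content {wt : Idx m n → ℂ} {w : W m n d} (hw : w ∈ weightSpace (W m n d) wt)
    (hw₀ : w ≠ 0) : ∃ f : Fin d → Idx m n, wt = fun i => (content f i : ℂ) := by
  obtain ⟨f, hf⟩ := exists_coord_ne_zero hw₀
  exact ⟨f, funext fun i => eq_content_of_coord_ne_zero (hw i) hf⟩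

/-- The projection of tensor space onto its weight space of weight `c`. -/
def contentProj (d : ℕ) (c : Idx m n → ℕ) : Module.End ℂ (W m n d) :=
  (tensorBasis m n d).constr ℂ fun f => if content f = c then tensorBasis m n d f else 0

theorem contentProj_basis (c : Idx m n → ℕ) (f : Fin d → Idx m n) :
    contentProj d c (tensorBasis m n d f) =
      if content f = c then tensorBasis m n d f else 0 :=
  (tensorBasis m n d).constr_basis ℂ _ f

theorem contentProj_mem_weightSpace (c : Idx m n → ℕ) (w : W m n d) :
    contentProj d c w ∈ weightSpace (W m n d) fun i => (c i : ℂ) := by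
  suffices h : LinearMap.range (contentProj d c) ≤ weightSpace (W m n d) fun i => (c i : ℂ) from
    h ⟨w, rfl⟩
  rw [contentProj, Module.Basis.constr_range, Submodule.span_le]
  rintro _ ⟨f, rfl⟩
  dsimp only
  split_ifs with h
  · exact h ▸ tensorBasis_mem_weightSpace f
  · exact zero_mem _

theorem permOp_mul_contentProj (σ : Equiv.Perm (Fin d)) (c : Idx m n → ℕ) :
    permOp m n σ * contentProj d c = contentProj d c * permOp m n σ := by
  refine (tensorBasis m n d).ext fun f => ?_
  rw [Module.End.mul_apply, Module.End.mul_apply, permOp_basis, map_smul, contentProj_basis,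
    contentProj_basis, content_comp_perm]
  split_ifs
  · rw [permOp_basis]
  · rw [map_zero, smul_zero]

theorem sum_contentProj :
    ∑ c ∈ Finset.univ.image (content (d := d)), contentProj d c = (1 : Module.End ℂ (W m n d)) := by
  refine (tensorBasis m n d).ext fun f => ?_
  simp only [LinearMap.sum_apply, contentProj_basis]
  rw [Finset.sum_ite_eq, if_pos (Finset.mem_image_of_mem _ (Finset.mem_univ f)),
    Module.End.one_apply]

variable {N : Submodule (UEA m n) (W m n d)}

theorem exists_weight_vector_mem (hN : N ≠ ⊥) :
    ∃ c : Idx m n → ℕ, ∃ w ∈ N, w ≠ 0 ∧ w ∈ weightSpace (W m n d) fun i => (c i : ℂ) := by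
  obtain ⟨w, hwN, hw₀⟩ := N.ne_bot_iff.mp hN
  obtain ⟨c, -, hc⟩ : ∃ c ∈ Finset.univ.image (content (d := d)), contentProj d c w ≠ 0 := by
    refine Finset.exists_ne_zero_of_sum_ne_zero ?_
    rwa [← LinearMap.sum_apply, sum_contentProj]
  obtain ⟨u, hu⟩ := mem_range_Φ_of_commute fun σ => permOp_mul_contentProj σ c
  refine ⟨c, contentProj d c w, ?_, hc, contentProj_mem_weightSpace c w⟩
  rw [← hu]
  exact N.smul_mem u hwN

theorem exists_isSingular_of_mem_weightSpace {wt : Idx m n → ℂ} {w : W m n d} {s : ℕ} (hwN : w ∈ N)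
    (hw₀ : w ≠ 0) (hw : w ∈ weightSpace (W m n d) wt) (hs : gradVal wt = s) :
    ∃ (wt' : Idx m n → ℂ) (v : W m n d), v ∈ N ∧ v ≠ 0 ∧ IsSingular wt' v := by
  induction s using Nat.strong_induction_on generalizing wt w with | _ s ih
  by_cases hsing : ∀ i j : Idx m n, toLex i < toLex j → unitE i j • w = 0
  · exact ⟨wt, w, hwN, hw₀, hsing, hw⟩
  push Not at hsing
  obtain ⟨i, j, hij, hne⟩ := hsing
  have hmem := unitE_smul_mem_weightSpace hw i j
  obtain ⟨f, hf⟩ := exists_eq_content hmem hne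
  have hgrad : gradVal (fun l => (content f l : ℂ)) = (∑ l, pos l * content f l : ℕ) := by
    simp only [gradVal, Nat.cast_sum, Nat.cast_mul]
  have hdrop : (∑ l, pos l * content f l) + pos j = s + pos i := by
    have h := gradVal_add_single_sub_single wt i j
    rw [hf, hgrad, hs] at h
    exact_mod_cast (show ((∑ l, pos l * content f l : ℕ) : ℂ) + pos j = s + pos i by rw [h]; ring)
  have hij := toLex_lt_iff.mp hij
  exact ih (∑ l, pos l * content f l) (by omega) (N.smul_mem _ hwN) hne hmem (by rw [hf, hgrad])

theorem exists_isSingular_mem (hN : N ≠ ⊥) :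
    ∃ (wt : Idx m n → ℂ) (v : W m n d), v ∈ N ∧ v ≠ 0 ∧ IsSingular wt v := by
  obtain ⟨c, w, hwN, hw₀, hw⟩ := exists_weight_vector_mem hN
  exact exists_isSingular_of_mem_weightSpace (s := ∑ i, pos i * c i) hwN hw₀ hw
    (by simp only [gradVal, Nat.cast_sum, Nat.cast_mul])

end TensorSpace

/-! ### The highest weights of tensor space -/

section EvenStrings

attribute [local instance] LieRing.ofAssociativeRing LieAlgebra.ofAssociativeAlgebra

variable {m n : ℕ} {M : Type*} [AddCommGroup M] [Module ℂ M] [Module (UEA m n) M]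
  [IsScalarTower ℂ (UEA m n) M] {wt : Idx m n → ℂ} {v : M} {i j : Idx m n}

theorem lie_unitE_self (k i j : Idx m n) :
    ⁅unitE k k, unitE i j⁆ = ((Pi.single i 1 - Pi.single j 1 : Idx m n → ℂ) k) • unitE i j := by
  rw [Ring.lie_def, unitE_self_mul_unitE, add_sub_cancel_left]

theorem isSl2Triple_unitE (hij : i ≠ j) (hpar : par i = par j)
    (h₀ : (unitE i i - unitE j j : UEA m n) ≠ 0) :
    IsSl2Triple (unitE i i - unitE j j) (unitE i j) (unitE j i) where
  h_ne_zero := h₀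
  lie_e_f := by
    rw [Ring.lie_def, unitE_mul_unitE, if_pos rfl, if_pos rfl, hpar, CharTwo.add_self_eq_zero,
      ksign_zero_left, one_smul, one_smul, add_sub_cancel_right]
  lie_h_e_nsmul := by
    rw [sub_lie, lie_unitE_self, lie_unitE_self]
    simp only [Pi.sub_apply, Pi.single_eq_same, Pi.single_eq_of_ne hij, Pi.single_eq_of_ne' hij]
    module
  lie_h_f_nsmul := by
    rw [sub_lie, lie_unitE_self, lie_unitE_self]
    simp only [Pi.sub_apply, Pi.single_eq_same, Pi.single_eq_of_ne hij, Pi.single_eq_of_ne' hij]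
    module

theorem IsSingular.exists_weight_sub_eq_nat [Module.Finite ℂ M] (hv : IsSingular wt v)
    (hv₀ : v ≠ 0) (hij : pos i < pos j) (hpar : par i = par j) : ∃ k : ℕ, wt i - wt j = k := by
  have hh : (unitE i i - unitE j j : UEA m n) • v = (wt i - wt j) • v := by
    rw [sub_smul, hv.mem_weightSpace, hv.mem_weightSpace, sub_smul]
  rcases eq_or_ne (unitE i i - unitE j j : UEA m n) 0 with h₀ | h₀
  · rw [h₀, zero_smul] at hh
    exact ⟨0, by simpa only [Nat.cast_zero] using (smul_eq_zero.mp hh.symm).resolve_right hv₀⟩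
  · let _ : LieRingModule (UEA m n) M := LieRingModule.ofAssociativeModule
    have _ : LieModule ℂ (UEA m n) M := LieModule.ofAssociativeModule
    have hprim : (isSl2Triple_unitE (ne_of_apply_ne pos hij.ne) hpar h₀).HasPrimitiveVectorWith
        v (wt i - wt j) := ⟨hv₀, hh, hv.upper i j (toLex_lt_iff.mpr hij)⟩
    exact hprim.exists_nat

theorem IsSingular.content_le {d : ℕ} {f : Fin d → Idx m n} {v : W m n d}
    (hv : IsSingular (fun i => (content f i : ℂ)) v) (hv₀ : v ≠ 0) (hij : pos i < pos j)
    (hpar : par i = par j) : content f j ≤ content f i := by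
  obtain ⟨k, hk⟩ := hv.exists_weight_sub_eq_nat hv₀ hij hpar
  rw [sub_eq_iff_eq_add'] at hk
  exact le_of_le_of_eq (Nat.le_add_right _ k) (by exact_mod_cast hk.symm)

end EvenStrings

section OddStrings

variable {m n d : ℕ} {M : Type*} [AddCommGroup M] [Module ℂ M] [Module (UEA m n) M]
  [IsScalarTower ℂ (UEA m n) M] {wt : Idx m n → ℂ} {i : Fin m} {k : ℕ} {v : M}

/-- The properties of `E_{k-1,i} ⋯ E_{0,i} v₀`, where `v₀` is a singular vector of weight `wt`, `i`
is an even index and `0, …, k - 1` are the first odd indices. -/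
structure IsOddString (wt : Idx m n → ℂ) (i : Fin m) (k : ℕ) (v : M) : Prop where
  odd_upper : ∀ j : Fin n, k ≤ j → (unitE (.inl i) (.inr j) : UEA m n) • v = 0
  even_upper : ∀ l j : Fin n, k ≤ j → l < j → (unitE (.inr l) (.inr j) : UEA m n) • v = 0
  unitE_inl_smul : (unitE (.inl i) (.inl i) : UEA m n) • v = (wt (.inl i) - k) • v
  unitE_inr_smul : ∀ j : Fin n, k ≤ j → (unitE (.inr j) (.inr j) : UEA m n) • v = wt (.inr j) • v

theorem IsSingular.isOddString_zero (hv : IsSingular wt v) (i : Fin m) :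
    IsOddString wt i 0 v where
  odd_upper j _ := hv.upper _ _ (Sum.Lex.inl_lt_inr i j)
  even_upper l j _ hlj := hv.upper _ _ (Sum.Lex.inr_lt_inr_iff.mpr hlj)
  unitE_inl_smul := by rw [Nat.cast_zero, sub_zero, hv.mem_weightSpace]
  unitE_inr_smul j _ := hv.mem_weightSpace _

theorem ksign_one_one : ksign 1 1 = -1 := by
  rw [ksign, ZMod.val_one, mul_one, pow_one]

theorem IsOddString.succ {k : Fin n} (hv : IsOddString wt i k v) :
    IsOddString wt i (k + 1) ((unitE (.inr k) (.inl i) : UEA m n) • v) where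
  odd_upper j hj := by
    rw [smul_smul, unitE_mul_unitE, if_neg (Sum.inr_injective.ne (Fin.ne_of_gt (by omega))),
      if_pos rfl, zero_sub, add_smul, neg_smul, smul_assoc, smul_assoc, mul_smul,
      hv.odd_upper j (by omega), hv.even_upper k j (by omega) (by omega)]
    simp only [smul_zero, neg_zero, add_zero]
  even_upper l j hj hlj := by
    rw [smul_smul, unitE_mul_unitE, if_neg (Sum.inr_injective.ne (Fin.ne_of_gt (by omega))),
      if_neg Sum.inl_ne_inr, smul_zero, sub_zero, zero_add, smul_assoc, mul_smul,
      hv.even_upper l j (by omega) hlj, smul_zero, smul_zero]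
  unitE_inl_smul := by
    rw [smul_smul, unitE_self_mul_unitE, add_smul, mul_smul, hv.unitE_inl_smul, smul_assoc,
      smul_algebra_smul_comm, ← add_smul]
    congr 1
    simp only [Pi.sub_apply, Pi.single_eq_same, Pi.single_eq_of_ne Sum.inl_ne_inr]
    push_cast
    ring
  unitE_inr_smul j hj := by
    have hjk : (Sum.inr j : Idx m n) ≠ .inr k :=
      Sum.inr_injective.ne (Fin.ne_of_gt (by omega))
    rw [smul_smul, unitE_self_mul_unitE, add_smul, mul_smul, hv.unitE_inr_smul j (by omega),
      smul_assoc, smul_algebra_smul_comm, ← add_smul]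
    congr 1
    simp only [Pi.sub_apply, Pi.single_eq_of_ne hjk, Pi.single_eq_of_ne Sum.inr_ne_inl, sub_zero,
      add_zero]

omit [IsScalarTower ℂ (UEA m n) M] in
theorem IsOddString.unitE_smul_unitE_smul {k : Fin n} (hv : IsOddString wt i k v) :
    (unitE (.inl i) (.inr k) : UEA m n) • (unitE (.inr k) (.inl i) : UEA m n) • v =
      (wt (.inl i) - k + wt (.inr k)) • v := by
  rw [smul_smul, unitE_mul_unitE, if_pos rfl, if_pos rfl]
  simp only [par, zero_add, add_zero, ksign_one_one, neg_smul, one_smul, sub_neg_eq_add]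
  rw [add_smul, add_smul, neg_smul, mul_smul, hv.odd_upper k le_rfl, hv.unitE_inl_smul,
    hv.unitE_inr_smul k le_rfl, smul_zero, neg_zero, add_zero, ← add_smul]

theorem IsSingular.lt_content {f : Fin d → Idx m n} {v : W m n d}
    (hv : IsSingular (fun i => (content f i : ℂ)) v) (hv₀ : v ≠ 0) (i : Fin m) (j : Fin n)
    (hj : 0 < content f (.inr j)) : (j : ℕ) < content f (.inl i) := by
  by_contra! hle
  have hstring (k : ℕ) (hk : k ≤ content f (.inl i) + 1) :
      ∃ w : W m n d, w ≠ 0 ∧ IsOddString (fun i => (content f i : ℂ)) i k w := by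
    induction k with
    | zero => exact ⟨v, hv₀, hv.isOddString_zero i⟩
    | succ k ih =>
      obtain ⟨w, hw₀, hw⟩ := ih (by omega)
      let k' : Fin n := ⟨k, by omega⟩
      have hpos : 0 < content f (.inr k') := by
        have hkj : k' ≤ j := Fin.le_def.mpr (by simp only [k']; omega)
        rcases hkj.eq_or_lt with h | h
        · rwa [h]
        · exact hj.trans_le (hv.content_le hv₀ (toLex_lt_iff.mp (Sum.Lex.inr_lt_inr_iff.mpr h)) rfl)
      refine ⟨_, fun h => ?_, IsOddString.succ (k := k') hw⟩
      have hzero := IsOddString.unitE_smul_unitE_smul (k := k') hw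
      rw [h, smul_zero, eq_comm, smul_eq_zero_iff_left hw₀, sub_add_eq_add_sub,
        sub_eq_zero] at hzero
      have hzero : content f (.inl i) + content f (.inr k') = k := by exact_mod_cast hzero
      omega
  obtain ⟨w, hw₀, hw⟩ := hstring _ le_rfl
  obtain ⟨g, hg⟩ := exists_coord_ne_zero hw₀
  have hneg := eq_content_of_coord_ne_zero hw.unitE_inl_smul hg
  rw [sub_eq_iff_eq_add] at hneg
  have hneg : content f (.inl i) = content g (.inl i) + (content f (.inl i) + 1) := by
    exact_mod_cast hneg
  omega

end OddStrings

/-! ### Hook partitions and highest weights -/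

section HookPartitions

variable {d m n : ℕ}

theorem mem_lowerPart {μ : YoungDiagram} {a b : ℕ} :
    (a, b) ∈ lowerPart m μ ↔ (m + a, b) ∈ μ := by
  rw [← YoungDiagram.mem_cells, ← YoungDiagram.mem_cells]
  simp only [lowerPart, Finset.mem_image, Finset.mem_filter, Prod.exists, Prod.mk.injEq]
  constructor
  · rintro ⟨a', b', ⟨h, hm⟩, rfl, rfl⟩
    rwa [Nat.add_sub_cancel' hm]
  · exact fun h => ⟨m + a, b, ⟨h, by omega⟩, by omega, rfl⟩

theorem lt_rowLen_transpose_lowerPart {μ : YoungDiagram} {a b : ℕ} :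
    a < (lowerPart m μ).transpose.rowLen b ↔ (m + a, b) ∈ μ := by
  rw [YoungDiagram.rowLen_transpose, ← YoungDiagram.mem_iff_lt_colLen, mem_lowerPart]

/-- The weight `μ^♮` with natural number coefficients. -/
def natWeight (m n : ℕ) (μ : YoungDiagram) : Idx m n → ℕ
  | .inl i => μ.rowLen i
  | .inr j => (lowerPart m μ).transpose.rowLen j

theorem natural_eq_natWeight (m n : ℕ) (μ : YoungDiagram) :
    natural m n μ = fun i => (natWeight m n μ i : ℂ) := by
  ext (i | j) <;> rfl

/-- The `k`-th box of letter `i` in a diagram of hook shape: row `i` for an even letter `i`, and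
column `i` below the first `m` rows for an odd one. -/
def hookCell : (Σ _ : Idx m n, ℕ) → ℕ × ℕ
  | ⟨.inl i, k⟩ => (i, k)
  | ⟨.inr j, k⟩ => (m + k, j)

theorem hookCell_injective :
    Function.Injective (hookCell : (Σ _ : Idx m n, ℕ) → ℕ × ℕ) := by
  rintro ⟨i | i, a⟩ ⟨j | j, b⟩ h <;> simp only [hookCell, Prod.mk.injEq] at h
  · obtain ⟨hij, rfl⟩ := h
    rw [Fin.ext hij]
  · omega
  · omega
  · obtain ⟨hab, hij⟩ := h
    rw [Fin.ext hij, Nat.add_left_cancel hab]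

/-- The boxes with `κ i` boxes of each letter `i`. -/
def hookCells (κ : Idx m n → ℕ) : Finset (ℕ × ℕ) :=
  (Finset.univ.sigma fun i => Finset.range (κ i)).map ⟨hookCell, hookCell_injective⟩

theorem card_hookCells (κ : Idx m n → ℕ) : (hookCells κ).card = ∑ i, κ i := by
  simp only [hookCells, Finset.card_map, Finset.card_sigma, Finset.card_range]

theorem hookCell_mem_hookCells {κ : Idx m n → ℕ} {i : Idx m n} {k : ℕ} :
    hookCell ⟨i, k⟩ ∈ hookCells κ ↔ k < κ i := by
  have h : hookCell ⟨i, k⟩ ∈ hookCells κ ↔ _ := Finset.mem_map' ⟨hookCell, hookCell_injective⟩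
  rw [h, Finset.mem_sigma, Finset.mem_range, and_iff_right (Finset.mem_univ i)]

theorem lt_or_lt_of_mem_hookCells {κ : Idx m n → ℕ} {a b : ℕ} (h : (a, b) ∈ hookCells κ) :
    a < m ∨ b < n := by
  obtain ⟨⟨i | j, k⟩, -, hab⟩ := Finset.mem_map.mp h <;> obtain ⟨rfl, rfl⟩ := Prod.ext_iff.mp hab
  · exact Or.inl i.2
  · exact Or.inr j.2

theorem exists_hookCell_eq {a b : ℕ} (h : a < m ∨ b < n) :
    ∃ p : Σ _ : Idx m n, ℕ, hookCell p = (a, b) := by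
  rcases lt_or_ge a m with ha | ha
  · exact ⟨⟨.inl ⟨a, ha⟩, b⟩, rfl⟩
  · obtain ⟨k, rfl⟩ := Nat.exists_eq_add_of_le ha
    exact ⟨⟨.inr ⟨b, by omega⟩, k⟩, rfl⟩

theorem hookCell_mem_iff_lt_natWeight {μ : YoungDiagram} {i : Idx m n} {k : ℕ} :
    hookCell ⟨i, k⟩ ∈ μ ↔ k < natWeight m n μ i := by
  rcases i with i | j
  · exact YoungDiagram.mem_iff_lt_rowLen
  · exact lt_rowLen_transpose_lowerPart.symm

theorem HookPartition.lt_or_lt (μ : HookPartition d m n) {a b : ℕ} (h : (a, b) ∈ μ.1) :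
    a < m ∨ b < n := by
  refine or_iff_not_imp_left.mpr fun ha => ?_
  exact (YoungDiagram.mem_iff_lt_rowLen.mp (μ.1.up_left_mem (not_lt.mp ha) le_rfl h)).trans_le μ.2.2

theorem HookPartition.cells_eq (μ : HookPartition d m n) :
    μ.1.cells = hookCells (natWeight m n μ.1) := by
  ext ⟨a, b⟩
  suffices a < m ∨ b < n → ((a, b) ∈ μ.1.cells ↔ (a, b) ∈ hookCells (natWeight m n μ.1)) from
    ⟨fun h => (this (μ.lt_or_lt h)).mp h, fun h => (this (lt_or_lt_of_mem_hookCells h)).mpr h⟩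
  intro hab
  obtain ⟨⟨i, k⟩, hik⟩ := exists_hookCell_eq hab
  rw [← hik, hookCell_mem_hookCells, YoungDiagram.mem_cells, hookCell_mem_iff_lt_natWeight]

theorem natural_injective {μ ν : HookPartition d m n}
    (h : natural m n μ.1 = natural m n ν.1) : μ = ν := by
  have hnat : natWeight m n μ.1 = natWeight m n ν.1 := by
    rw [natural_eq_natWeight, natural_eq_natWeight] at h
    exact funext fun i => Nat.cast_injective (congrFun h i)
  exact Subtype.ext (YoungDiagram.ext (by rw [μ.cells_eq, ν.cells_eq, hnat]))

/-- The weights `κ` that are `μ^♮` for some partition `μ` of hook shape. -/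
structure IsHookWeight (κ : Idx m n → ℕ) : Prop where
  antitone_inl : Antitone fun i => κ (.inl i)
  antitone_inr : Antitone fun j => κ (.inr j)
  lt_inl : ∀ i (j : Fin n), 0 < κ (.inr j) → (j : ℕ) < κ (.inl i)

theorem IsHookWeight.isLowerSet_hookCells {κ : Idx m n → ℕ} (hκ : IsHookWeight κ) :
    IsLowerSet (hookCells κ : Set (ℕ × ℕ)) := by
  rintro ⟨a, b⟩ ⟨a', b'⟩ hab h
  obtain ⟨ha, hb⟩ := Prod.mk_le_mk.mp hab
  rw [Finset.mem_coe] at h ⊢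
  obtain ⟨⟨i | j, k⟩, hik⟩ := exists_hookCell_eq (lt_or_lt_of_mem_hookCells h) <;>
    rw [← hik, hookCell_mem_hookCells] at h <;> obtain ⟨rfl, rfl⟩ := Prod.ext_iff.mp hik
  · have hi : κ (.inl i) ≤ κ (.inl ⟨a', ha.trans_lt i.2⟩) := hκ.antitone_inl ha
    exact hookCell_mem_hookCells (i := .inl ⟨a', ha.trans_lt i.2⟩).mpr (hb.trans_lt (h.trans_le hi))
  · rcases lt_or_ge a' m with ha' | ha'
    · exact hookCell_mem_hookCells (i := .inl ⟨a', ha'⟩).mpr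
        (hb.trans_lt (hκ.lt_inl _ j (Nat.zero_lt_of_lt h)))
    · obtain ⟨k', rfl⟩ := Nat.exists_eq_add_of_le ha'
      have hj : κ (.inr j) ≤ κ (.inr ⟨b', hb.trans_lt j.2⟩) := hκ.antitone_inr hb
      exact hookCell_mem_hookCells (i := .inr ⟨b', hb.trans_lt j.2⟩).mpr
        ((Nat.le_of_add_le_add_left ha).trans_lt (h.trans_le hj))

theorem IsHookWeight.exists_hookPartition {κ : Idx m n → ℕ} (hκ : IsHookWeight κ)
    (hd : ∑ i, κ i = d) : ∃ μ : HookPartition d m n, natWeight m n μ.1 = κ := by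
  let μ : YoungDiagram := ⟨hookCells κ, hκ.isLowerSet_hookCells⟩
  refine ⟨⟨μ, (card_hookCells κ).trans hd, ?_⟩, ?_⟩
  · by_contra! h
    have := lt_or_lt_of_mem_hookCells (YoungDiagram.mem_iff_lt_rowLen.mpr h : (m, n) ∈ μ)
    omega
  · exact funext fun i => eq_of_forall_lt_iff fun k =>
      hookCell_mem_iff_lt_natWeight.symm.trans hookCell_mem_hookCells

theorem IsSingular.isHookWeight_content {f : Fin d → Idx m n} {v : W m n d}
    (hv : IsSingular (fun i => (content f i : ℂ)) v) (hv₀ : v ≠ 0) : IsHookWeight (content f) where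
  antitone_inl := antitone_iff_forall_lt.mpr fun _ _ hij =>
    hv.content_le hv₀ (toLex_lt_iff.mp (Sum.Lex.inl_lt_inl_iff.mpr hij)) rfl
  antitone_inr := antitone_iff_forall_lt.mpr fun _ _ hij =>
    hv.content_le hv₀ (toLex_lt_iff.mp (Sum.Lex.inr_lt_inr_iff.mpr hij)) rfl
  lt_inl := hv.lt_content hv₀

theorem IsSingular.exists_natural_eq {wt : Idx m n → ℂ} {v : W m n d} (hv : IsSingular wt v)
    (hv₀ : v ≠ 0) : ∃ μ : HookPartition d m n, natural m n μ.1 = wt := by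
  obtain ⟨f, rfl⟩ := exists_eq_content hv.mem_weightSpace hv₀
  obtain ⟨μ, hμ⟩ := (hv.isHookWeight_content hv₀).exists_hookPartition (sum_content f)
  exact ⟨μ, by rw [natural_eq_natWeight, hμ]⟩

end HookPartitions

/-! ### Young symmetrizers -/

section FiberPerms

variable {α β : Type*} (φ : α → β)

/-- The group of the permutations that preserve every fiber of `φ`. -/
def fiberPerms : Subgroup (Equiv.Perm α) where
  carrier := {σ | ∀ a, φ (σ a) = φ a}
  one_mem' _ := rfl
  mul_mem' hσ hτ a := (hσ _).trans (hτ a)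
  inv_mem' {σ} hσ a := (hσ _).symm.trans (congrArg φ (σ.apply_symm_apply a))

instance [Fintype α] [DecidableEq β] : DecidablePred (· ∈ fiberPerms φ) :=
  fun σ => inferInstanceAs (Decidable (∀ a, φ (σ a) = φ a))

variable {φ}

theorem comp_symm_eq_of_mem_fiberPerms {σ : Equiv.Perm α} (hσ : σ ∈ fiberPerms φ) :
    φ ∘ σ.symm = φ :=
  funext ((fiberPerms φ).inv_mem hσ)

theorem swap_mem_fiberPerms [DecidableEq α] {x y : α} (h : φ x = φ y) :
    Equiv.swap x y ∈ fiberPerms φ := by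
  intro a
  rw [Equiv.swap_apply_def]
  split_ifs with hx hy
  · rw [hx, h]
  · rw [hy, h]
  · rfl

end FiberPerms

section Young

variable {d : ℕ} {μ : YoungDiagram} (T : Fin d ≃ μ.cells)

/-- The group of the permutations that preserve the rows of a tableau. -/
abbrev rowPerms : Subgroup (Equiv.Perm (Fin d)) := fiberPerms fun x => (T x).1.1

/-- The group of the permutations that preserve the columns of a tableau. -/
abbrev colPerms : Subgroup (Equiv.Perm (Fin d)) := fiberPerms fun x => (T x).1.2

theorem rowSymmetrizer_eq_sum :
    rowSymmetrizer T = ∑ σ : rowPerms T, MonoidAlgebra.of ℂ _ (σ : Equiv.Perm (Fin d)) :=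
  Finset.sum_subtype _ (fun _ => Finset.mem_filter_univ _) _

theorem colAntisymmetrizer_eq_sum :
    colAntisymmetrizer T = ∑ τ : colPerms T,
      (Equiv.Perm.sign (τ : Equiv.Perm (Fin d)) : ℤ) •
        MonoidAlgebra.of ℂ _ (τ : Equiv.Perm (Fin d)) :=
  Finset.sum_subtype _ (fun _ => Finset.mem_filter_univ _)
    fun τ => (Equiv.Perm.sign τ : ℤ) • MonoidAlgebra.of ℂ _ τ

/-- The Young symmetrizer of a tableau. -/
def youngSymm : GroupAlg d := colAntisymmetrizer T * rowSymmetrizer T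

variable {T}

theorem of_mul_rowSymmetrizer {σ : Equiv.Perm (Fin d)} (hσ : σ ∈ rowPerms T) :
    MonoidAlgebra.of ℂ _ σ * rowSymmetrizer T = rowSymmetrizer T := by
  rw [rowSymmetrizer_eq_sum, Finset.mul_sum]
  exact Fintype.sum_equiv (Equiv.mulLeft ⟨σ, hσ⟩) _ _ fun τ => (map_mul _ _ _).symm

theorem rowSymmetrizer_mul_of {σ : Equiv.Perm (Fin d)} (hσ : σ ∈ rowPerms T) :
    rowSymmetrizer T * MonoidAlgebra.of ℂ _ σ = rowSymmetrizer T := by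
  rw [rowSymmetrizer_eq_sum, Finset.sum_mul]
  exact Fintype.sum_equiv (Equiv.mulRight ⟨σ, hσ⟩) _ _ fun τ => (map_mul _ _ _).symm

theorem colAntisymmetrizer_mul_of {σ : Equiv.Perm (Fin d)} (hσ : σ ∈ colPerms T) :
    colAntisymmetrizer T * MonoidAlgebra.of ℂ _ σ =
      (Equiv.Perm.sign σ : ℤ) • colAntisymmetrizer T := by
  rw [colAntisymmetrizer_eq_sum, Finset.sum_mul, Finset.smul_sum]
  refine Fintype.sum_equiv (Equiv.mulRight ⟨σ, hσ⟩) _ _ fun τ => ?_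
  simp only [Equiv.coe_mulRight, Subgroup.coe_mul]
  rw [map_mul, smul_mul_assoc, smul_smul, map_mul, Units.val_mul, mul_left_comm,
    ← Units.val_mul, Int.units_mul_self, Units.val_one, mul_one]

theorem colAntisymmetrizer_mul_swap {x y : Fin d} (hxy : x ≠ y) (h : (T x).1.2 = (T y).1.2) :
    colAntisymmetrizer T * MonoidAlgebra.of ℂ _ (Equiv.swap x y) = -colAntisymmetrizer T := by
  rw [colAntisymmetrizer_mul_of (swap_mem_fiberPerms h), Equiv.Perm.sign_swap hxy, Units.val_neg,
    Units.val_one, neg_one_smul]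

theorem card_filter_tableau (p : ℕ × ℕ → Prop) [DecidablePred p] :
    (Finset.univ.filter fun x => p (T x).1).card = (μ.cells.filter p).card :=
  Finset.card_bij (fun x _ => (T x).1)
    (fun x hx => Finset.mem_filter.mpr ⟨(T x).2, (Finset.mem_filter.mp hx).2⟩)
    (fun _ _ _ _ h => T.injective (Subtype.ext h))
    fun c hc => ⟨T.symm ⟨c, (Finset.mem_filter.mp hc).1⟩, by
      simpa using (Finset.mem_filter.mp hc).2⟩

theorem card_filter_row_lt_and_col_eq (k b : ℕ) :
    (Finset.univ.filter fun x => (T x).1.1 < k ∧ (T x).1.2 = b).card = min k (μ.colLen b) := by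
  rw [card_filter_tableau fun c => c.1 < k ∧ c.2 = b]
  have h : (μ.cells.filter fun c => c.1 < k ∧ c.2 = b) =
      Finset.range (min k (μ.colLen b)) ×ˢ {b} := by
    ext ⟨a, b'⟩
    simp only [Finset.mem_filter, YoungDiagram.mem_cells, YoungDiagram.mem_iff_lt_colLen,
      Finset.mem_product, Finset.mem_range, Finset.mem_singleton, lt_min_iff]
    constructor
    · rintro ⟨ha, hk, rfl⟩
      exact ⟨⟨hk, ha⟩, rfl⟩
    · rintro ⟨⟨hk, ha⟩, rfl⟩
      exact ⟨ha, hk, rfl⟩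
  rw [h, Finset.card_product, Finset.card_range, Finset.card_singleton, mul_one]

theorem card_filter_col_eq (b : ℕ) :
    (Finset.univ.filter fun x => (T x).1.2 = b).card = μ.colLen b := by
  rw [card_filter_tableau fun c => c.2 = b, YoungDiagram.colLen_eq_card, YoungDiagram.col]

theorem card_filter_lt_and_col_eq_le {r : Fin d → ℕ}
    (hr : ∀ x y, (T x).1.2 = (T y).1.2 → r x = r y → x = y) (k b : ℕ) :
    (Finset.univ.filter fun x => r x < k ∧ (T x).1.2 = b).card ≤ min k (μ.colLen b) := by
  refine le_min ?_ ?_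
  · refine (Finset.card_le_card_of_injOn (t := Finset.range k) r (fun x hx => ?_)
      fun x hx y hy hxy => ?_).trans_eq (Finset.card_range k)
    · exact Finset.mem_coe.mpr (Finset.mem_range.mpr (Finset.mem_filter.mp hx).2.1)
    · exact hr x y ((Finset.mem_filter.mp hx).2.2.trans (Finset.mem_filter.mp hy).2.2.symm) hxy
  · rw [← card_filter_col_eq (T := T)]
    exact Finset.card_le_card (Finset.monotone_filter_right _ fun x _ hx => hx.2)

-- Each column has at most as many boxes with `r < k` as boxes in the first `k` rows. As the totals
-- agree, so do the counts in each column; take `k` to be the length of the column of `x`.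
theorem lt_colLen_of_injOn_col {r : Fin d → ℕ}
    (hr : ∀ x y, (T x).1.2 = (T y).1.2 → r x = r y → x = y)
    (hcard : ∀ k, (Finset.univ.filter fun x => r x < k).card =
      (Finset.univ.filter fun x => (T x).1.1 < k).card) (x : Fin d) :
    r x < μ.colLen (T x).1.2 := by
  set b := (T x).1.2 with hb
  set k := μ.colLen b
  have hsum (q : Fin d → ℕ) : (Finset.univ.filter fun x => q x < k).card =
      ∑ b ∈ Finset.univ.image fun x => (T x).1.2,
        (Finset.univ.filter fun x => q x < k ∧ (T x).1.2 = b).card := by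
    simp only [← Finset.filter_filter]
    exact Finset.card_eq_sum_card_fiberwise fun x _ => Finset.mem_image_of_mem _ (Finset.mem_univ x)
  have hcol : (Finset.univ.filter fun x => r x < k ∧ (T x).1.2 = b).card =
      (Finset.univ.filter fun x => (T x).1.1 < k ∧ (T x).1.2 = b).card := by
    have h := hcard k
    rw [hsum, hsum, Finset.sum_eq_sum_iff_of_le fun b _ =>
      (card_filter_lt_and_col_eq_le hr k b).trans_eq (card_filter_row_lt_and_col_eq k b).symm] at h
    exact h b (Finset.mem_image_of_mem _ (Finset.mem_univ x))
  have hfull : (Finset.univ.filter fun x => r x < k ∧ (T x).1.2 = b) =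
      Finset.univ.filter fun x => (T x).1.2 = b :=
    Finset.eq_of_subset_of_card_le (Finset.monotone_filter_right _ fun x _ hx => hx.2) (by
      rw [hcol, card_filter_row_lt_and_col_eq, card_filter_col_eq, min_self])
  exact (Finset.mem_filter.mp (hfull.ge (Finset.mem_filter.mpr ⟨Finset.mem_univ x, hb.symm⟩))).2.1

theorem exists_colPerms_mul_rowPerms_eq {g : Equiv.Perm (Fin d)}
    (hg : ∀ x y, (T x).1.2 = (T y).1.2 → (T (g⁻¹ x)).1.1 = (T (g⁻¹ y)).1.1 → x = y) :
    ∃ τ ∈ colPerms T, ∃ σ ∈ rowPerms T, g = τ * σ := by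
  have hcard (k : ℕ) : (Finset.univ.filter fun x => (T (g⁻¹ x)).1.1 < k).card =
      (Finset.univ.filter fun x => (T x).1.1 < k).card :=
    Finset.card_equiv g⁻¹ fun x => by simp only [Finset.mem_filter_univ]
  have hmem (x : Fin d) : ((T (g⁻¹ x)).1.1, (T x).1.2) ∈ μ.cells :=
    YoungDiagram.mem_iff_lt_colLen.mpr (lt_colLen_of_injOn_col hg hcard x)
  have hinj : Function.Injective fun x => T.symm ⟨_, hmem x⟩ := fun x y hxy => by
    obtain ⟨hrow, hcol⟩ := Prod.ext_iff.mp (congrArg Subtype.val (T.symm.injective hxy))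
    exact hg x y hcol hrow
  let ρ : Equiv.Perm (Fin d) := Equiv.ofBijective _ (Finite.injective_iff_bijective.mp hinj)
  have hρ (x : Fin d) : T (ρ x) = ⟨_, hmem x⟩ := T.apply_symm_apply _
  refine ⟨ρ⁻¹, inv_mem fun x => ?_, ρ * g, fun x => ?_, (inv_mul_cancel_left ρ g).symm⟩
  · exact congrArg (fun c => c.1.2) (hρ x)
  · refine (congrArg (fun c => c.1.1) (hρ (g x))).trans ?_
    exact congrArg (fun y => (T y).1.1) (g.symm_apply_apply x)

theorem colAntisymmetrizer_mul_of_mul_rowSymmetrizer_eq_zero {g : Equiv.Perm (Fin d)} {x y : Fin d}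
    (hxy : x ≠ y) (hcol : (T x).1.2 = (T y).1.2) (hrow : (T (g⁻¹ x)).1.1 = (T (g⁻¹ y)).1.1) :
    colAntisymmetrizer T * MonoidAlgebra.of ℂ _ g * rowSymmetrizer T = 0 := by
  have : IsAddTorsionFree (GroupAlg d) := .of_isTorsionFree ℂ _
  refine self_eq_neg.mp ?_
  calc colAntisymmetrizer T * MonoidAlgebra.of ℂ _ g * rowSymmetrizer T
      = colAntisymmetrizer T * MonoidAlgebra.of ℂ _ (g * Equiv.swap (g⁻¹ x) (g⁻¹ y)) *
          rowSymmetrizer T := by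
        rw [map_mul, ← mul_assoc (colAntisymmetrizer T), mul_assoc (colAntisymmetrizer T * _),
          of_mul_rowSymmetrizer (swap_mem_fiberPerms hrow)]
    _ = colAntisymmetrizer T * MonoidAlgebra.of ℂ _ (Equiv.swap x y * g) * rowSymmetrizer T := by
        rw [Equiv.swap_mul_eq_mul_swap]
    _ = -(colAntisymmetrizer T * MonoidAlgebra.of ℂ _ g * rowSymmetrizer T) := by
        rw [map_mul, ← mul_assoc, colAntisymmetrizer_mul_swap hxy hcol, neg_mul, neg_mul]

theorem exists_colAntisymmetrizer_mul_mul_rowSymmetrizer_eq (a : GroupAlg d) :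
    ∃ z : ℂ, colAntisymmetrizer T * a * rowSymmetrizer T = z • youngSymm T := by
  induction a using MonoidAlgebra.induction_on with
  | of g =>
    by_cases hg : ∀ x y, (T x).1.2 = (T y).1.2 → (T (g⁻¹ x)).1.1 = (T (g⁻¹ y)).1.1 → x = y
    · obtain ⟨τ, hτ, σ, hσ, rfl⟩ := exists_colPerms_mul_rowPerms_eq hg
      refine ⟨(Equiv.Perm.sign τ : ℤ), ?_⟩
      rw [map_mul, ← mul_assoc, colAntisymmetrizer_mul_of hτ, mul_assoc, of_mul_rowSymmetrizer hσ,
        smul_mul_assoc, youngSymm, Int.cast_smul_eq_zsmul]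
    · push Not at hg
      obtain ⟨x, y, hcol, hrow, hxy⟩ := hg
      refine ⟨0, ?_⟩
      rw [colAntisymmetrizer_mul_of_mul_rowSymmetrizer_eq_zero hxy hcol hrow, zero_smul]
  | add a b ha hb =>
    obtain ⟨z, hz⟩ := ha
    obtain ⟨z', hz'⟩ := hb
    exact ⟨z + z', by rw [mul_add, add_mul, hz, hz', add_smul]⟩
  | smul r a ha =>
    obtain ⟨z, hz⟩ := ha
    exact ⟨r * z, by rw [mul_smul_comm, smul_mul_assoc, hz, smul_smul]⟩

theorem scalarCorner_youngSymm : ScalarCorner ℂ (youngSymm T) := by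
  intro a
  obtain ⟨z, hz⟩ := exists_colAntisymmetrizer_mul_mul_rowSymmetrizer_eq (T := T)
    (rowSymmetrizer T * a * colAntisymmetrizer T)
  exact ⟨z, by rw [← hz]; simp only [youngSymm, mul_assoc]⟩

end Young

/-! ### Signs of permutations that preserve a word -/

section FiberSigns

variable {m n d : ℕ} {f : Fin d → Idx m n}

theorem permSign_one : permSign 1 f = 1 := by
  rw [permSign, Finset.filter_false_of_mem, Finset.prod_empty]
  exact fun _ _ h => lt_asymm h.1 h.2

theorem permSign_eq_one {τ : Equiv.Perm (Fin d)} (hτ : ∀ x, par (f x) = 1 → τ x = x) :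
    permSign τ f = 1 := by
  refine Finset.prod_eq_one fun ⟨x, y⟩ hxy => ?_
  obtain ⟨hlt, hgt⟩ : x < y ∧ τ y < τ x := (Finset.mem_filter.mp hxy).2
  have hpar (p : ZMod 2) : p = 0 ∨ p = 1 := by revert p; decide
  rcases hpar (par (f x)) with hx | hx
  · rw [hx, ksign_zero_left]
  rcases hpar (par (f y)) with hy | hy
  · rw [hy, ksign_comm, ksign_zero_left]
  · rw [hτ x hx, hτ y hy] at hgt
    exact absurd hgt hlt.not_gt

-- The inversions other than the swapped pair cancel under `(a, b) ↦ (s b, s a)`.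
theorem permSign_swap {x y : Fin d} (hxy : x ≠ y) (h : f x = f y) :
    permSign (Equiv.swap x y) f = ksign (par (f x)) (par (f x)) := by
  wlog hlt : x < y generalizing x y
  · rw [Equiv.swap_comm, this hxy.symm h.symm (hxy.symm.lt_of_le (not_lt.mp hlt)), h]
  have hf (a : Fin d) : f (Equiv.swap x y a) = f a := swap_mem_fiberPerms h a
  have hmem : (x, y) ∈ Finset.univ.filter fun ab : Fin d × Fin d =>
      ab.1 < ab.2 ∧ Equiv.swap x y ab.2 < Equiv.swap x y ab.1 := by
    simpa using hlt
  rw [permSign, ← Finset.mul_prod_erase _ _ hmem, Finset.prod_involution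
    fun ab _ => (Equiv.swap x y ab.2, Equiv.swap x y ab.1), mul_one, h]
  · intro ab _
    rw [hf, hf, ksign_comm (par (f ab.2)), ksign_mul_self]
  · rintro ⟨a, b⟩ hab - heq
    simp only [Finset.mem_erase, Finset.mem_filter_univ, ne_eq, Prod.mk.injEq] at hab heq
    grind
  · rintro ⟨a, b⟩ hab
    simp only [Finset.mem_erase, Finset.mem_filter_univ, ne_eq, Prod.mk.injEq,
      Equiv.swap_apply_self] at hab ⊢
    exact ⟨fun heq => hab.1 (by grind), hab.2.2, hab.2.1⟩
  · intro ab _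
    simp only [Equiv.swap_apply_self, Prod.mk.eta]

theorem permSign_eq_sign {τ : Equiv.Perm (Fin d)} (hτ : τ ∈ fiberPerms f)
    (hodd : ∀ x, τ x ≠ x → par (f x) = 1) : permSign τ f = (Equiv.Perm.sign τ : ℤ) := by
  let S : Set (Equiv.Perm (Fin d)) :=
    {s | ∃ x y, x ≠ y ∧ f x = f y ∧ par (f x) = 1 ∧ s = Equiv.swap x y}
  have hS : Subgroup.closure S ≤ fiberPerms f := by
    rw [Subgroup.closure_le]
    rintro _ ⟨x, y, -, hf, -, rfl⟩
    exact swap_mem_fiberPerms hf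
  have hstep (s) (hs : s ∈ S) (τ) (hτ : τ ∈ Subgroup.closure S)
      (ih : permSign τ f = (Equiv.Perm.sign τ : ℤ)) :
      permSign (s * τ) f = (Equiv.Perm.sign (s * τ) : ℤ) := by
    obtain ⟨x, y, hxy, hf, hx, rfl⟩ := hs
    rw [permSign_mul, comp_symm_eq_of_mem_fiberPerms (hS hτ), permSign_swap hxy hf, ih, hx,
      ksign_one_one, map_mul, Equiv.Perm.sign_swap hxy]
    simp only [neg_one_mul, Units.val_neg, Int.cast_neg]
  have hmem : τ ∈ Subgroup.closure S := by
    refine (mem_closure_isSwap ?_).mpr ⟨Set.toFinite _, fun x => ?_⟩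
    · rintro _ ⟨x, y, hxy, -, -, rfl⟩
      exact ⟨x, y, hxy, rfl⟩
    · by_cases hx : τ x = x
      · rw [hx]
        exact MulAction.mem_orbit_self x
      · exact ⟨⟨_, Subgroup.subset_closure ⟨x, τ x, Ne.symm hx, (hτ x).symm, hodd x hx, rfl⟩⟩,
          Equiv.swap_apply_left x (τ x)⟩
  clear hτ hodd
  induction hmem using Subgroup.closure_induction_left with
  | one => rw [permSign_one, map_one, Units.val_one, Int.cast_one]
  | mul_left s hs τ hτ ih => exact hstep s hs τ hτ ih
  | inv_mul_cancel s hs τ hτ ih =>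
    have hinv : s⁻¹ = s := by
      obtain ⟨x, y, -, -, -, rfl⟩ := hs
      exact Equiv.swap_inv x y
    rw [hinv]
    exact hstep s hs τ hτ ih

end FiberSigns

/-! ### The singular vectors `c_T e_f` -/

section Vanishing

variable {m n d : ℕ} {μ : YoungDiagram} {T : Fin d ≃ μ.cells} {f : Fin d → Idx m n} {x y : Fin d}

theorem of_smul_basis (σ : Equiv.Perm (Fin d)) (f : Fin d → Idx m n) :
    MonoidAlgebra.of ℂ _ σ • tensorBasis m n d f =
      permSign σ f • tensorBasis m n d (f ∘ σ.symm) := by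
  rw [groupAlg_smul_def, Ψ_of, permOp_basis]

theorem swap_smul_basis (hxy : x ≠ y) (h : f x = f y) :
    MonoidAlgebra.of ℂ _ (Equiv.swap x y) • tensorBasis m n d f =
      ksign (par (f x)) (par (f x)) • tensorBasis m n d f := by
  rw [of_smul_basis, permSign_swap hxy h, comp_symm_eq_of_mem_fiberPerms (swap_mem_fiberPerms h)]

theorem rowSymmetrizer_smul_eq_zero (hxy : x ≠ y) (h : f x = f y) (hrow : (T x).1.1 = (T y).1.1)
    (hodd : par (f x) = 1) : rowSymmetrizer T • tensorBasis m n d f = 0 := by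
  have : IsAddTorsionFree (W m n d) := .of_isTorsionFree ℂ _
  refine self_eq_neg.mp ?_
  conv_lhs => rw [← rowSymmetrizer_mul_of (swap_mem_fiberPerms hrow), mul_smul,
    swap_smul_basis hxy h, hodd, ksign_one_one, smul_algebra_smul_comm, neg_smul, one_smul]

theorem colAntisymmetrizer_smul_eq_zero (hxy : x ≠ y) (h : f x = f y)
    (hcol : (T x).1.2 = (T y).1.2) (heven : par (f x) = 0) :
    colAntisymmetrizer T • tensorBasis m n d f = 0 := by
  have : IsAddTorsionFree (W m n d) := .of_isTorsionFree ℂ _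
  refine self_eq_neg.mp ?_
  rw [← neg_smul, ← colAntisymmetrizer_mul_swap hxy hcol, mul_smul, swap_smul_basis hxy h, heven,
    ksign_zero_left, one_smul]

-- Every rearrangement of `f` along the rows has the letter `i` twice in the column of the image of
-- `x`: there, and in row `i`.
theorem youngSymm_smul_eq_zero_of_inl {i : Fin m} (hf : ∀ y, (T y).1.1 = i → f y = .inl i)
    (hx : f x = .inl i) (hi : (i : ℕ) < (T x).1.1) : youngSymm T • tensorBasis m n d f = 0 := by
  rw [youngSymm, mul_smul, rowSymmetrizer_eq_sum, Finset.sum_smul, Finset.smul_sum]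
  refine Finset.sum_eq_zero fun ⟨σ, hσ⟩ _ => ?_
  have hrow : (T (σ x)).1.1 = (T x).1.1 := hσ x
  have hmem : ((i : ℕ), (T (σ x)).1.2) ∈ μ.cells :=
    μ.up_left_mem (hi.le.trans_eq hrow.symm) le_rfl (T (σ x)).2
  obtain ⟨y, hy⟩ := T.surjective ⟨_, hmem⟩
  have hne : σ x ≠ y := by
    rintro rfl
    rw [← hrow, hy] at hi
    exact lt_irrefl _ hi
  have hfx : (f ∘ σ.symm) (σ x) = .inl i := by rw [Function.comp_apply, σ.symm_apply_apply, hx]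
  have hfy : (f ∘ σ.symm) y = .inl i :=
    hf _ (((rowPerms T).inv_mem hσ y).trans (congrArg (fun c => c.1.1) hy))
  rw [of_smul_basis, smul_algebra_smul_comm, colAntisymmetrizer_smul_eq_zero hne
    (hfx.trans hfy.symm) (by rw [hy]) (by rw [hfx, par]), smul_zero]

theorem youngSymm_smul_eq_zero_of_inr {j : Fin n} (hxy : x ≠ y) (hx : f x = .inr j)
    (hy : f y = .inr j) (hrow : (T x).1.1 = (T y).1.1) :
    youngSymm T • tensorBasis m n d f = 0 := by
  rw [youngSymm, mul_smul, rowSymmetrizer_smul_eq_zero hxy (hx.trans hy.symm) hrow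
    (by rw [hx, par]), smul_zero]

end Vanishing

section HookWord

variable {m n d : ℕ} (μ : HookPartition d m n) (T : Fin d ≃ μ.1.cells)

/-- The word whose letter at a box is the row of the box for the first `m` rows, and its column
below them. -/
def hookWord (x : Fin d) : Idx m n :=
  if h : (T x).1.1 < m then .inl ⟨(T x).1.1, h⟩
  else .inr ⟨(T x).1.2, (μ.lt_or_lt (T x).2).resolve_left h⟩

variable {μ T}

theorem hookWord_eq_inl {x : Fin d} {i : Fin m} : hookWord μ T x = .inl i ↔ (T x).1.1 = i := by
  rw [hookWord]
  split_ifs with h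
  · rw [Sum.inl.injEq, Fin.ext_iff]
  · simp only [false_iff]
    omega

theorem hookWord_eq_inr {x : Fin d} {j : Fin n} :
    hookWord μ T x = .inr j ↔ m ≤ (T x).1.1 ∧ (T x).1.2 = j := by
  rw [hookWord]
  split_ifs with h
  · simp only [false_iff]
    omega
  · rw [Sum.inr.injEq, Fin.ext_iff, and_iff_right (not_lt.mp h)]

theorem hookWord_eq_iff {x : Fin d} {i : Idx m n} :
    hookWord μ T x = i ↔ ∃ k, hookCell ⟨i, k⟩ = (T x).1 := by
  rcases i with i | j
  · rw [hookWord_eq_inl]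
    exact ⟨fun h => ⟨(T x).1.2, Prod.ext h.symm rfl⟩, fun ⟨k, hk⟩ => (congrArg Prod.fst hk).symm⟩
  · rw [hookWord_eq_inr]
    constructor
    · exact fun h => ⟨(T x).1.1 - m, Prod.ext (Nat.add_sub_cancel' h.1) h.2.symm⟩
    · rintro ⟨k, hk⟩
      rw [← hk]
      exact ⟨Nat.le_add_right m k, rfl⟩

theorem content_hookWord : content (hookWord μ T) = natWeight m n μ.1 := by
  ext i
  rw [content, ← Finset.card_range (natWeight m n μ.1 i)]
  refine (Finset.card_bij (fun k hk => T.symm ⟨hookCell ⟨i, k⟩,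
    hookCell_mem_iff_lt_natWeight.mpr (Finset.mem_range.mp hk)⟩) ?_ ?_ ?_).symm
  · intro k hk
    rw [Finset.mem_filter_univ, hookWord_eq_iff, T.apply_symm_apply]
    exact ⟨k, rfl⟩
  · intro k _ k' _ h
    exact eq_of_heq (Sigma.mk.inj (hookCell_injective
      (congrArg Subtype.val (T.symm.injective h)))).2
  · intro x hx
    obtain ⟨k, hk⟩ := hookWord_eq_iff.mp (Finset.mem_filter.mp hx).2
    refine ⟨k, Finset.mem_range.mpr (hookCell_mem_iff_lt_natWeight.mp ?_), ?_⟩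
    · rw [hk]
      exact (T x).2
    · rw [T.symm_apply_eq]
      exact Subtype.ext hk

variable (μ T) in
/-- The vector obtained from the word `hookWord` by the Young symmetrizer; it is singular of weight
`μ^♮`. -/
def hookVector : W m n d := youngSymm T • tensorBasis m n d (hookWord μ T)

theorem youngSymm_smul_update_hookWord_eq_zero {i : Idx m n} {x : Fin d}
    (hi : toLex i < toLex (hookWord μ T x)) :
    youngSymm T • tensorBasis m n d (Function.update (hookWord μ T) x i) = 0 := by
  have hself : Function.update (hookWord μ T) x i x = i := Function.update_self ..
  rcases i with i | i
  · have hrow : (i : ℕ) < (T x).1.1 := by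
      rcases h : hookWord μ T x with j | j <;> rw [h] at hi
      · rw [hookWord_eq_inl.mp h]
        exact Fin.lt_def.mp (Sum.Lex.inl_lt_inl_iff.mp hi)
      · exact i.2.trans_le (hookWord_eq_inr.mp h).1
    refine youngSymm_smul_eq_zero_of_inl (fun y hy => ?_) hself hrow
    rw [Function.update_of_ne (by rintro rfl; omega), hookWord_eq_inl, hy]
  · rcases h : hookWord μ T x with j | j <;> rw [h] at hi
    · exact absurd hi Sum.Lex.not_inr_lt_inl
    · obtain ⟨hrow, hcol⟩ := hookWord_eq_inr.mp h
      have hij : (i : ℕ) < (T x).1.2 :=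
        hcol ▸ Fin.lt_def.mp (Sum.Lex.inr_lt_inr_iff.mp hi)
      obtain ⟨y, hy⟩ := T.surjective ⟨((T x).1.1, (i : ℕ)), μ.1.up_left_mem le_rfl hij.le (T x).2⟩
      have hyx : y ≠ x := by
        rintro rfl
        rw [hy] at hij
        exact lt_irrefl _ hij
      refine youngSymm_smul_eq_zero_of_inr hyx ?_ hself (by rw [hy])
      rw [Function.update_of_ne hyx, hookWord_eq_inr, hy]
      exact ⟨hrow, rfl⟩

theorem isSingular_hookVector : IsSingular (natural m n μ.1) (hookVector μ T) where
  upper i j hij := by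
    rw [hookVector, ← smul_comm (youngSymm T), unitE_smul_basis, Finset.smul_sum]
    refine Finset.sum_eq_zero fun x _ => ?_
    split_ifs with h
    · rw [smul_algebra_smul_comm, youngSymm_smul_update_hookWord_eq_zero (h ▸ hij), smul_zero]
    · rw [smul_zero]
  mem_weightSpace i := by
    rw [hookVector, ← smul_comm (youngSymm T), tensorBasis_mem_weightSpace, smul_algebra_smul_comm,
      content_hookWord, natural_eq_natWeight]

section Stabilizer

variable {τ σ : Equiv.Perm (Fin d)} {x : Fin d}

theorem eq_of_row_eq_of_col_eq {x y : Fin d} (hrow : (T x).1.1 = (T y).1.1)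
    (hcol : (T x).1.2 = (T y).1.2) : x = y :=
  T.injective (Subtype.ext (Prod.ext hrow hcol))

theorem apply_eq_self_of_hookWord_eq_inr {j : Fin n} (hτ : τ ∈ colPerms T) (hσ : σ ∈ rowPerms T)
    (h : τ * σ ∈ fiberPerms (hookWord μ T)) (hx : hookWord μ T x = .inr j) : σ x = x := by
  refine eq_of_row_eq_of_col_eq (hσ x) ((hτ (σ x)).symm.trans ?_)
  exact (hookWord_eq_inr.mp ((h x).trans hx)).2.trans (hookWord_eq_inr.mp hx).2.symm

theorem apply_eq_self_of_hookWord_eq_inl {i : Fin m} (hτ : τ ∈ colPerms T)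
    (h : τ ∈ fiberPerms (hookWord μ T)) (hx : hookWord μ T x = .inl i) : τ x = x :=
  eq_of_row_eq_of_col_eq
    ((hookWord_eq_inl.mp ((h x).trans hx)).trans (hookWord_eq_inl.mp hx).symm) (hτ x)

theorem mem_fiberPerms_hookWord (hτ : τ ∈ colPerms T) (hσ : σ ∈ rowPerms T)
    (h : τ * σ ∈ fiberPerms (hookWord μ T)) : σ ∈ fiberPerms (hookWord μ T) := by
  intro x
  rcases hx : hookWord μ T x with i | j
  · exact hookWord_eq_inl.mpr ((hσ x).trans (hookWord_eq_inl.mp hx))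
  · rw [apply_eq_self_of_hookWord_eq_inr hτ hσ h hx, hx]

-- `σ` only moves even letters and `τ` only odd ones.
theorem sign_mul_permSign_hookWord (hτ : τ ∈ colPerms T) (hσ : σ ∈ rowPerms T)
    (h : τ * σ ∈ fiberPerms (hookWord μ T)) :
    ((Equiv.Perm.sign τ : ℤ) : ℂ) * permSign (τ * σ) (hookWord μ T) = 1 := by
  have hσf := mem_fiberPerms_hookWord hτ hσ h
  have hτf : τ ∈ fiberPerms (hookWord μ T) := ((fiberPerms _).mul_mem_cancel_right hσf).mp h
  have hsignσ : permSign σ (hookWord μ T) = 1 := permSign_eq_one fun x hx => by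
    rcases hx' : hookWord μ T x with i | j
    · rw [hx', par] at hx
      exact absurd hx zero_ne_one
    · exact apply_eq_self_of_hookWord_eq_inr hτ hσ h hx'
  have hsignτ : permSign τ (hookWord μ T) = (Equiv.Perm.sign τ : ℤ) :=
    permSign_eq_sign hτf fun x hx => by
      rcases hx' : hookWord μ T x with i | j
      · exact absurd (apply_eq_self_of_hookWord_eq_inl hτ hτf hx') hx
      · rfl
  rw [permSign_mul, comp_symm_eq_of_mem_fiberPerms hσf, hsignσ, mul_one, hsignτ, ← Int.cast_mul,
    ← Units.val_mul, Int.units_mul_self, Units.val_one, Int.cast_one]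

end Stabilizer

theorem hookVector_eq_sum : hookVector μ T = ∑ τ : colPerms T, ∑ σ : rowPerms T,
    (((Equiv.Perm.sign (τ : Equiv.Perm (Fin d)) : ℤ) : ℂ) *
      permSign (τ * σ : Equiv.Perm (Fin d)) (hookWord μ T)) •
        tensorBasis m n d (hookWord μ T ∘ (τ * σ : Equiv.Perm (Fin d)).symm) := by
  rw [hookVector, youngSymm, colAntisymmetrizer_eq_sum, rowSymmetrizer_eq_sum,
    Finset.sum_mul_sum, Finset.sum_smul]
  refine Finset.sum_congr rfl fun τ _ => ?_
  rw [Finset.sum_smul]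
  refine Finset.sum_congr rfl fun σ _ => ?_
  rw [smul_mul_assoc, ← map_mul, ← Int.cast_smul_eq_zsmul ℂ, smul_assoc, of_smul_basis, smul_smul]

theorem coord_hookVector : (tensorBasis m n d).coord (hookWord μ T) (hookVector μ T) =
    (Finset.univ.filter fun p : colPerms T × rowPerms T =>
      hookWord μ T ∘ (p.1 * p.2 : Equiv.Perm (Fin d)).symm = hookWord μ T).card := by
  rw [hookVector_eq_sum, ← Fintype.sum_prod_type', map_sum, Finset.cast_card, Finset.sum_filter]
  refine Finset.sum_congr rfl fun ⟨⟨τ, hτ⟩, ⟨σ, hσ⟩⟩ _ => ?_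
  rw [map_smul, Module.Basis.coord_apply, Module.Basis.repr_self, smul_eq_mul]
  split_ifs with h
  · have hmem : (τ * σ)⁻¹ ∈ fiberPerms (hookWord μ T) := congrFun h
    rw [h, Finsupp.single_eq_same, mul_one, sign_mul_permSign_hookWord hτ hσ (inv_mem_iff.mp hmem)]
  · rw [Finsupp.single_eq_of_ne' h, mul_zero]

theorem hookVector_ne_zero : hookVector μ T ≠ 0 := by
  intro h
  have hcard := coord_hookVector (T := T)
  rw [h, map_zero, eq_comm, Nat.cast_eq_zero, Finset.card_eq_zero] at hcard
  exact Finset.notMem_empty ((1, 1) : colPerms T × rowPerms T)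
    (hcard ▸ (Finset.mem_filter_univ _).mpr rfl)

end HookWord

/-! ### Schur–Sergeev duality -/

theorem centralizer_range_Φ (m n d : ℕ) :
    Subalgebra.centralizer ℂ ((Φ m n d).range : Set (Module.End ℂ (W m n d))) =
      (Ψ m n d).range := by
  refine le_antisymm (fun T hT => ?_) ?_
  · rw [Subalgebra.mem_centralizer_iff] at hT
    obtain ⟨a, ha⟩ := exists_smul_eq_of_commute (A := GroupAlg d) (T := T) fun β w => by
      obtain ⟨u, hu⟩ := exists_UEA_smul_eq β
      rw [← hu, ← hu]
      exact (LinearMap.congr_fun (hT _ ⟨u, rfl⟩) w).symm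
    exact ⟨a, LinearMap.ext ha⟩
  · rintro _ ⟨s, rfl⟩
    rw [Subalgebra.mem_centralizer_iff]
    rintro _ ⟨u, rfl⟩
    exact (commute_Ψ_Φ s u).symm

section Hook

variable {m n d : ℕ} (μ : HookPartition d m n)

/-- The Young symmetrizer whose left ideal is the Specht module. -/
def hookSymm : GroupAlg d := youngSymm (tableau μ.1 μ.2.1)

theorem scalarCorner_hookSymm : ScalarCorner ℂ (hookSymm μ) := scalarCorner_youngSymm

theorem exists_hookSymm_smul_ne_zero : ∃ w : W m n d, hookSymm μ • w ≠ 0 :=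
  ⟨_, hookVector_ne_zero (T := tableau μ.1 μ.2.1)⟩

theorem hookSymm_ne_zero : hookSymm μ ≠ 0 := by
  obtain ⟨w, hw⟩ := exists_hookSymm_smul_ne_zero μ
  intro h
  rw [h, zero_smul] at hw
  exact hw rfl

instance isSimpleModule_hookImage :
    IsSimpleModule (UEA m n) (actImage (UEA m n) (W m n d) (hookSymm μ)) :=
  (scalarCorner_hookSymm μ).isSimpleModule_actImage exists_UEA_smul_eq
    (exists_hookSymm_smul_ne_zero μ)

theorem exists_isSingular_hookImage :
    ∃ v : actImage (UEA m n) (W m n d) (hookSymm μ), v ≠ 0 ∧ IsSingular (natural m n μ.1) v := by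
  have hv := isSingular_hookVector (T := tableau μ.1 μ.2.1)
  refine ⟨⟨hookVector μ (tableau μ.1 μ.2.1), _, rfl⟩, fun h => ?_, fun i j hij => ?_, fun i => ?_⟩
  · exact hookVector_ne_zero (congrArg Subtype.val h)
  · exact Subtype.ext (hv.upper i j hij)
  · exact Subtype.ext (hv.mem_weightSpace i)

theorem nonempty_L_equiv_hookImage :
    Nonempty (L (natural m n μ.1) ≃ₗ[UEA m n] actImage (UEA m n) (W m n d) (hookSymm μ)) := by
  obtain ⟨v, hv₀, hv⟩ := exists_isSingular_hookImage μ
  exact hv.nonempty_L_equiv hv₀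

theorem isSimpleModule_L_natural : IsSimpleModule (UEA m n) (L (natural m n μ.1)) :=
  isSimpleModule_iff_isCoatom.mpr
    ((isSingular_hookVector (T := tableau μ.1 μ.2.1)).isCoatom_sSup_verma hookVector_ne_zero)

theorem isSimpleModule_specht : IsSimpleModule (GroupAlg d) (Specht μ.1 μ.2.1) :=
  (scalarCorner_hookSymm μ).isSimpleModule_span (hookSymm_ne_zero μ)

variable {μ} {ν : HookPartition d m n}

theorem eq_of_hookImage_equiv (e : actImage (UEA m n) (W m n d) (hookSymm μ) ≃ₗ[UEA m n]
    actImage (UEA m n) (W m n d) (hookSymm ν)) : μ = ν := by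
  obtain ⟨v, hv₀, hv⟩ := exists_isSingular_hookImage μ
  obtain ⟨v', hv₀', hv'⟩ := exists_isSingular_hookImage ν
  exact natural_injective (hv.weight_eq_of_equiv hv₀ hv' hv₀' e)

theorem isEmpty_L_equiv (h : μ ≠ ν) :
    IsEmpty (L (natural m n μ.1) ≃ₗ[UEA m n] L (natural m n ν.1)) := by
  obtain ⟨θ⟩ := nonempty_L_equiv_hookImage μ
  obtain ⟨θ'⟩ := nonempty_L_equiv_hookImage ν
  exact ⟨fun e => h (eq_of_hookImage_equiv ((θ.symm.trans e).trans θ'))⟩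

theorem hookSymm_mul_mul_eq_zero (h : μ ≠ ν) (y : GroupAlg d) :
    hookSymm μ * y * hookSymm ν = 0 := by
  by_contra hy
  obtain ⟨e⟩ := (scalarCorner_hookSymm ν).nonempty_actImage_equiv (scalarCorner_hookSymm μ)
    exists_UEA_smul_eq (exists_hookSymm_smul_ne_zero ν) (exists_hookSymm_smul_ne_zero μ) hy
  exact h (eq_of_hookImage_equiv e).symm

theorem isEmpty_specht_equiv (h : μ ≠ ν) :
    IsEmpty (Specht μ.1 μ.2.1 ≃ₗ[GroupAlg d] Specht ν.1 ν.2.1) :=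
  isEmpty_span_equiv (hookSymm_mul_mul_eq_zero h) (hookSymm_ne_zero μ)

end Hook

theorem annihilated_hookSymm_eq_bot (m n d : ℕ) :
    annihilated (W m n d) (hookSymm (m := m) (n := n) (d := d)) = ⊥ := by
  obtain ⟨u, hone, hzero⟩ := exists_smul_eq_projection (W := W m n d) exists_UEA_smul_eq
    (hookSymm (m := m) (n := n) (d := d))
  let N : Submodule (UEA m n) (W m n d) :=
    { annihilated (W m n d) (hookSymm (m := m) (n := n) (d := d)) with
      smul_mem' := fun b w hw i a => by
        rw [smul_comm a b, smul_comm (hookSymm i) b, hw, smul_zero] }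
  by_contra hne
  obtain ⟨w, hw, hw₀⟩ := Submodule.exists_mem_ne_zero_of_ne_bot hne
  obtain ⟨wt, v, hvN, hv₀, hv⟩ := exists_isSingular_mem (N.ne_bot_iff.mpr ⟨w, hw, hw₀⟩)
  obtain ⟨μ, rfl⟩ := hv.exists_natural_eq hv₀
  obtain ⟨z, hz₀, hz⟩ := exists_isSingular_hookImage μ
  -- `1 - u` kills `v` but acts as the identity on the image of `hookSymm μ`
  have hv_smul : (1 - u) • v = 0 := by rw [sub_smul, one_smul, hone v hvN, sub_self]
  have hz_smul : u • z = 0 := by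
    obtain ⟨w, hw⟩ := z.2
    exact Subtype.ext ((congrArg (u • ·) hw.symm).trans (hzero μ w))
  apply hz₀
  calc z = (1 - u) • z + u • z := by rw [← add_smul, sub_add_cancel, one_smul]
    _ = 0 := by rw [hv.smul_eq_zero_of_smul_eq_zero hv₀ hz hv_smul, hz_smul, add_zero]

theorem span_hookSymm_smul_eq_top (m n d : ℕ) :
    Submodule.span (GroupAlg d)
      {v : W m n d | ∃ (μ : HookPartition d m n) (w : W m n d), hookSymm μ • w = v} = ⊤ := by
  have h := isCompl_span_annihilated (W := W m n d) (hookSymm (m := m) (n := n) (d := d))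
  rw [annihilated_hookSymm_eq_bot] at h
  exact eq_top_of_isCompl_bot h

theorem exists_decomposition (m n d : ℕ) :
    ∃ e : W m n d ≃ₗ[ℂ] Decomp m n d, ∀ (u : UEA m n) (s : GroupAlg d) (w : W m n d),
      e (Φ m n d u (Ψ m n d s w)) = decompAct m n d u s (e w) := by
  classical
  exact exists_bimodule_decomposition (U := UEA m n) (W := W m n d) hookSymm scalarCorner_hookSymm
    (fun _ _ h => hookSymm_mul_mul_eq_zero h) (span_hookSymm_smul_eq_top m n d)
    (fun μ => L (natural m n μ.1)) (fun μ => (nonempty_L_equiv_hookImage μ).some)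

end SchurSergeev

end

open SchurSergeev in
theorem theorem3p1 (m n d : ℕ) :
    -- the double centralizer property
    ((Φ m n d).range = Subalgebra.centralizer ℂ ((Ψ m n d).range : Set (Module.End ℂ (W m n d))) ∧
      Subalgebra.centralizer ℂ ((Φ m n d).range : Set (Module.End ℂ (W m n d))) =
        (Ψ m n d).range) ∧
    -- the decomposition, as modules over `U(gl(m|n)) ⊗ ℂ𝔖_d`
    (∃ e : W m n d ≃ₗ[ℂ] Decomp m n d, ∀ (u : UEA m n) (s : GroupAlg d) (w : W m n d),
      e (Φ m n d u (Ψ m n d s w)) = decompAct m n d u s (e w)) ∧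
    -- it is multiplicity-free: the factors are simple and pairwise non-isomorphic
    (∀ μ : HookPartition d m n, IsSimpleModule (UEA m n) (L (natural m n μ.1)) ∧
      IsSimpleModule (GroupAlg d) (Specht μ.1 μ.2.1)) ∧
    (∀ μ ν : HookPartition d m n, μ ≠ ν →
      IsEmpty (L (natural m n μ.1) ≃ₗ[UEA m n] L (natural m n ν.1)) ∧
      IsEmpty (Specht μ.1 μ.2.1 ≃ₗ[GroupAlg d] Specht ν.1 ν.2.1)) :=
  ⟨⟨range_Φ_eq_centralizer m n d, centralizer_range_Φ m n d⟩, exists_decomposition m n d,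
    fun μ => ⟨isSimpleModule_L_natural μ, isSimpleModule_specht μ⟩,
    fun _ _ h => ⟨isEmpty_L_equiv h, isEmpty_specht_equiv h⟩⟩
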